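/- **Setting.** Let $b,\sigma:\mathbb R\to\mathbb R$ be smooth, with $\sigma$ bounded, $\sigma^2\ge S_1$ for some $S_1>0$, and $$\lim_{|x|\to\infty}\frac{-b(x)\,x}{|x|}=\infty ,\qquad \lim_{|x|\to\infty}\frac{-s(x)\,x}{|x|}=\infty ,\qquad s:=b-\sigma\sigma'.$$ (The second limit follows from the first if $\sigma'$ is bounded.) Let $h>0$, $x_j=jh$ for $j\in\mathbb Z$, $s^+=\max(s,0)$, $s^-=\max(-s,0)$, and let $$\alpha_j=\frac{s^+(x_j)}{h}+\frac{\sigma(x_j+\frac h2)^2}{2h^2},\qquad \beta_j=\frac{s^-(x_j)}{h}+\frac{\sigma(x_j-\frac h2)^2}{2h^2}$$ be the rates at which a continuous-time Markov chain $Z$ on $\mathbb Z$ jumps from $j$ to $j+1$ and from $j$ to $j-1$, respectively. Let $p_t(i,j)=\mathbb P(Z(t)=j\mid Z(0)=i)$ be its transition function, that is, the stochastic ($p_t(i,j)\ge0$, $\sum_jp_t(i,j)=1$) solution of the Chapman–Kolmogorov equations with $p_0(i,j)=\delta_{ij}$ whose derivative at $t=0$ is the rate matrix $Q(j,j+1)=\alpha_j$,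 $Q(j,j-1)=\beta_j$, $Q(j,j)=-(\alpha_j+\beta_j)$, $Q(i,j)=0$ otherwise. Let $\pi^h$ be its stationary distribution, i.e. the probability distribution on $\mathbb Z$ with $\alpha_{j-1}\pi^h_{j-1}+\beta_{j+1}\pi^h_{j+1}-(\alpha_j+\beta_j)\pi^h_j=0$ for all $j$. Let $(\mathcal L_hu)_j=\beta_ju_{j-1}-(\alpha_j+\beta_j)u_j+\alpha_ju_{j+1}$, and for $u(0)\in\ell^\infty$ let $S(t)u(0)=e^{t\mathcal L_h}u(0):=u(t)$, where $u$ is the solution of $\frac{d}{dt}u_j=(\mathcal L_hu)_j$ on $[0,\infty)$ with initial value $u(0)$ that is bounded on $[0,\infty)\times\mathbb Z$. Finally let $\ell^p(\pi^h)$ be the space of sequences with $\|q\|_{\ell^p(\pi^h)}=\big(\sum_j\pi^h_j|q_j|^p\big)^{1/p}<\infty$ (the supremum norm for $p=\infty$). **Proposition 4.1.** The transition function $p_t$, the stationary distribution $\pi^h$ and, for each $u(0)\in\ell^\infty$, the bounded solution $u$ exist and are unique. For every $p\in[1,\infty]$ and $t\ge0$, there is exactly one bounded linear operator on $\ell^p(\pi^h)$,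 again denoted by $S(t)$, that agrees with $S(t)$ on bounded sequences. Moreover: 1. For any $u(0)\in\ell^\infty$, $t\ge0$ and $j\in\mathbb Z$, $\;(S(t)u(0))_j=\sum_{i\in\mathbb Z}p_t(j,i)\,u_i(0)$. 2. $S(t)$ is TVD: if $u(0)\in\ell^1$ and $u(t)=S(t)u(0)$, then $\sum_j|u_j(t)-u_{j-1}(t)|$ is finite for all $t\ge0$ and nonincreasing in $t$. 3. $S(t)$ is symmetric in $\ell^2(\pi^h)$ for any $t\ge0$. 4. $S(t)$ is a contraction in $\ell^p(\pi^h)$ (that is, $\|S(t)q\|_{\ell^p(\pi^h)}\le\|q\|_{\ell^p(\pi^h)}$ for all $q\in\ell^p(\pi^h)$) for any $p\in[1,\infty]$ and $t\ge0$. -/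

import Mathlib

open MeasureTheory Filter Topology
open scoped NNReal ENNReal ContDiff

noncomputable section

namespace Upwind

/-- `-b(x) x / |x| → ∞` as `|x| → ∞`. -/
def Confining (b : ℝ → ℝ) : Prop :=
  Tendsto (fun x : ℝ => -b x * x / |x|) (cocompact ℝ) atTop

/-- The speed `s = b - σ σ'` of the Fokker-Planck equation in conservative form,
`∂ₜρ = -∂ₓ(s ρ) + ½ ∂ₓ(σ² ∂ₓρ)`. -/
def speed (b σ : ℝ → ℝ) (x : ℝ) : ℝ := b x - σ x * deriv σ x

/-- The weak confinement assumption on the drift `b` and the diffusion coefficient `σ`. -/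
structure WeakConfinement (b σ : ℝ → ℝ) : Prop where
  smooth_drift : ContDiff ℝ ∞ b
  smooth_diffusion : ContDiff ℝ ∞ σ
  confining : Confining b
  bounded : ∃ M : ℝ, ∀ x, |σ x| ≤ M
  nondegenerate : ∃ S₁ : ℝ, 0 < S₁ ∧ ∀ x, S₁ ≤ σ x ^ 2

/-- The rate `α_j = s⁺(x_j) / h + σ(x_j + h/2)² / (2h²)` of jumping from `j` to `j + 1`, where
`x_j = j h`. -/
def upRate (b σ : ℝ → ℝ) (h : ℝ) (j : ℤ) : ℝ :=
  max (speed b σ (j * h)) 0 / h + σ (j * h + h / 2) ^ 2 / (2 * h ^ 2)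

/-- The rate `β_j = s⁻(x_j) / h + σ(x_j - h/2)² / (2h²)` of jumping from `j` to `j - 1`. -/
def downRate (b σ : ℝ → ℝ) (h : ℝ) (j : ℤ) : ℝ :=
  max (-speed b σ (j * h)) 0 / h + σ (j * h - h / 2) ^ 2 / (2 * h ^ 2)

/-- The matrix of jump rates (the `Q`-matrix): `Q(i, i+1) = α_i`, `Q(i, i-1) = β_i`,
`Q(i, i) = -(α_i + β_i)`, and `0` elsewhere. -/
def rateMatrix (α β : ℤ → ℝ) (i j : ℤ) : ℝ :=
  if j = i + 1 then α i
  else if j = i - 1 then β i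
  else if j = i then -(α i + β i)
  else 0

/-- The forward operator `L_h^*`. -/
def forwardOp (α β : ℤ → ℝ) (q : ℤ → ℝ) (j : ℤ) : ℝ :=
  α (j - 1) * q (j - 1) + β (j + 1) * q (j + 1) - (α j + β j) * q j

/-- The backward operator `L_h`. -/
def backwardOp (α β : ℤ → ℝ) (u : ℤ → ℝ) (j : ℤ) : ℝ :=
  β j * u (j - 1) - (α j + β j) * u j + α j * u (j + 1)

/-- `p t i j = P(Z(t) = j | Z(0) = i)` is the transition function of a continuous time Markov chain
`Z` on `ℤ` with the given jump rates: it is stochastic, it satisfies the Chapman-Kolmogorov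
equations, it starts at the identity, and its derivative at `t = 0` is the matrix of jump rates. -/
structure IsTransitionFunction (α β : ℤ → ℝ) (p : ℝ≥0 → ℤ → ℤ → ℝ) : Prop where
  nonneg : ∀ t i j, 0 ≤ p t i j
  hasSum_one : ∀ t i, HasSum (fun j => p t i j) 1
  initial : ∀ i j, p 0 i j = if i = j then 1 else 0
  chapman_kolmogorov : ∀ s t i j, HasSum (fun k => p s i k * p t k j) (p (s + t) i j)
  rates : ∀ i j, HasDerivWithinAt (fun t : ℝ => p t.toNNReal i j) (rateMatrix α β i j)
    (Set.Ici 0) 0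

/-- `w` is a stationary distribution: a probability distribution on `ℤ` that is a stationary
solution of the forward equation. -/
structure IsStationaryDistribution (α β : ℤ → ℝ) (w : ℤ → ℝ) : Prop where
  nonneg : ∀ j, 0 ≤ w j
  hasSum_one : HasSum w 1
  stationary : ∀ j, forwardOp α β w j = 0

/-- `u ∈ ℓ^∞`. -/
def IsBounded (u : ℤ → ℝ) : Prop := ∃ C : ℝ, ∀ j, |u j| ≤ C

/-- `u` is a bounded solution on `[0, ∞)` of the backward equation `du_j/dt = (L_h u)_j` with
initial value `u₀`. Where it is unique, `S(t) u₀ = u t` for the semigroup `S(t) = e^{t L_h}`. -/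
structure IsBackwardSolution (α β : ℤ → ℝ) (u₀ : ℤ → ℝ) (u : ℝ≥0 → ℤ → ℝ) : Prop where
  initial : u 0 = u₀
  bounded : ∃ C : ℝ, ∀ t j, |u t j| ≤ C
  equation : ∀ (t : ℝ≥0) (j : ℤ), HasDerivWithinAt (fun s : ℝ => u s.toNNReal j)
    (backwardOp α β (u t) j) (Set.Ici 0) (t : ℝ)

/-- The measure on `ℤ` with the masses `w j`, so that `Lp ℝ p (weightMeasure w)` is `ℓ^p(w)`. -/
def weightMeasure (w : ℤ → ℝ) : Measure ℤ :=
  Measure.sum fun j => ENNReal.ofReal (w j) • Measure.dirac j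

/-- `T` is the operator `S(t) = e^{t L_h}` on `ℓ^p(w)`: the bounded linear operator on `ℓ^p(w)`
which on bounded sequences `u₀` is given by the bounded solution of the backward equation. (For
`p < ∞`, `ℓ^p(w)` may contain unbounded sequences; if `∑ w_j < ∞`, the bounded ones are dense
in it.) -/
def IsSemigroupOn (α β : ℤ → ℝ) (w : ℤ → ℝ) (p : ℝ≥0∞) [Fact (1 ≤ p)] (t : ℝ≥0)
    (T : Lp ℝ p (weightMeasure w) →L[ℝ] Lp ℝ p (weightMeasure w)) : Prop :=
  ∀ (u₀ : ℤ → ℝ) (u : ℝ≥0 → ℤ → ℝ), IsBounded u₀ → IsBackwardSolution α β u₀ u →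
    ∀ hu₀ : MemLp u₀ p (weightMeasure w), T (hu₀.toLp u₀) =ᵐ[weightMeasure w] u t

end Upwind

end

/-! Only the signs and growth of the rates matter: they are positive, the outward ones are bounded,
and the inward ones tend to infinity (`WeakConfinement.inwardRates`). Hence `L_h` applied to `|j|`
is bounded above by some `C`, and `|j| + C t` is a supersolution growing at infinity. Adding a small
multiple of it reduces comparison of bounded solutions on `ℤ` to a maximum principle on a finite
set. This gives uniqueness, order preservation and, for truncations to `[-N, N]`, a Cauchy estimate
of order `1 / N`, hence existence.

The solutions starting at point masses form the columns of a kernel, and the same barrier shows that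
the kernel represents every bounded solution. Conversely, the columns of any transition function
solve the backward equation (`IsTransitionFunction.backward`), so the kernel is the only one.

For the TVD property, the initial value is, up to a constant, a difference of two bounded increasing
sequences. Monotone data stay monotone (`IsBackwardSolution.monotone`) and within their bounds, so
the variation of each part does not grow.

A stationary distribution carries a constant flux across edges; boundedness of the outward rates
forces this flux to vanish, which is detailed balance. Truncated rate matrices inherit detailed
balance, as do their exponentials and, in the limit, `p t`. Symmetry in `ℓ²` is then an exchange of
summations; contraction is Jensen's inequality together with invariance. Density of bounded
sequences for `p < ∞` makes the operator unique. -/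

namespace Upwind

/-! ### Maximum principle on a finite set -/

/-- If the values at the positive maxima over a finite set are decreasing in time, then the
functions stay nonpositive. -/
theorem nonpos_of_deriv_neg_at_max {X : Type*} (K : Finset X) (w w' : ℝ → X → ℝ)
    (hd : ∀ t, 0 ≤ t → ∀ x ∈ K, HasDerivWithinAt (fun s => w s x) (w' t x) (Set.Ici 0) t)
    (h0 : ∀ x ∈ K, w 0 x ≤ 0)
    (hneg : ∀ t, 0 < t → ∀ x ∈ K, 0 < w t x → (∀ y ∈ K, w t y ≤ w t x) → w' t x < 0) :
    ∀ t, 0 ≤ t → ∀ x ∈ K, w t x ≤ 0 := by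
  intro T hT x hx
  by_contra! hpos
  -- The pair `(τ y, y)` chosen below maximizes `w` over `[0, T] × K`. Membership in `K` sits inside
  -- the existential so that `τ` is a total function.
  have hmax : ∀ y : X, ∃ s ∈ Set.Icc (0 : ℝ) T, y ∈ K → ∀ r ∈ Set.Icc (0 : ℝ) T,
      w r y ≤ w s y := by
    intro y
    by_cases hy : y ∈ K
    · have hc : ContinuousOn (fun s => w s y) (Set.Icc 0 T) := fun s hs =>
        ((hd s hs.1 y hy).continuousWithinAt).mono Set.Icc_subset_Ici_self
      obtain ⟨s, hs, hmax⟩ := isCompact_Icc.exists_isMaxOn ⟨0, by simp [hT]⟩ hc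
      exact ⟨s, hs, fun _ r hr => hmax hr⟩
    · exact ⟨0, by simp [hT], fun h => absurd h hy⟩
  choose τ hτ hτmax using hmax
  obtain ⟨y, hy, hymax⟩ := K.exists_max_image (fun y => w (τ y) y) ⟨x, hx⟩
  have hall : ∀ z ∈ K, ∀ r ∈ Set.Icc (0 : ℝ) T, w r z ≤ w (τ y) y := fun z hz r hr =>
    (hτmax z hz r hr).trans (hymax z hz)
  have hp : 0 < w (τ y) y := hpos.trans_le (hall x hx T ⟨hT, le_rfl⟩)
  have ht0 : 0 < τ y := by
    rcases (hτ y).1.lt_or_eq with h | h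
    · exact h
    · rw [← h] at hp
      exact absurd (h0 y hy) (not_le.mpr hp)
  have hlt := hneg (τ y) ht0 y hy hp fun z hz => hall z hz _ (hτ y)
  have hder : HasDerivWithinAt (fun s => w s y) (w' (τ y) y) (Set.Icc 0 (τ y)) (τ y) :=
    (hd (τ y) ht0.le y hy).mono Set.Icc_subset_Ici_self
  -- The maximal time may be the endpoint `T`, so only slopes from the left are used; they are
  -- nonnegative.
  have hder2 : HasDerivWithinAt (fun s => w s y) (w' (τ y) y) (Set.Iio (τ y)) (τ y) := by
    refine (hd (τ y) ht0.le y hy).mono_of_mem_nhdsWithin ?_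
    exact mem_nhdsWithin_of_mem_nhds (Ici_mem_nhds ht0)
  rw [hasDerivWithinAt_iff_tendsto_slope' (by simp)] at hder2
  have hge : 0 ≤ w' (τ y) y := by
    refine ge_of_tendsto hder2 ?_
    have : ∀ᶠ s in 𝓝[<] (τ y), s ∈ Set.Ioo 0 (τ y) := Ioo_mem_nhdsLT ht0
    filter_upwards [this] with s hs
    rw [slope_def_field]
    have h1 := hall y hy s ⟨hs.1.le, hs.2.le.trans (hτ y).2⟩
    exact div_nonneg_of_nonpos (by linarith) (by linarith [hs.2])
  linarith

/-! ### Comparison and uniqueness for inward rates -/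

/-- Positive jump rates such that those pointing away from the origin are bounded, and those pointing
towards the origin tend to infinity. -/
structure InwardRates (α β : ℤ → ℝ) : Prop where
  up_pos : ∀ j, 0 < α j
  down_pos : ∀ j, 0 < β j
  outward_bounded : ∃ A : ℝ, (∀ j, 0 ≤ j → α j ≤ A) ∧ (∀ j, j ≤ 0 → β j ≤ A)
  down_tendsto : Tendsto β atTop atTop
  up_tendsto : Tendsto α atBot atTop

variable {α β : ℤ → ℝ}

/-- For `j > 0` the value is `α j - β j`, for `j < 0` it is `β j - α j`, and at `0` it is `α 0 + β
0`; only outward rates enter with a positive sign. This Lyapunov bound is what rules out explosion.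
-/
theorem InwardRates.exists_drift_bound (hr : InwardRates α β) :
    ∃ C : ℝ, 0 ≤ C ∧ ∀ j, backwardOp α β (fun i => |(i : ℝ)|) j ≤ C := by
  obtain ⟨A, hA, hB⟩ := hr.outward_bounded
  have hA0 := (hr.up_pos 0).trans_le (hA 0 le_rfl)
  refine ⟨2 * A, by linarith, fun j => ?_⟩
  have ha := hr.up_pos j
  have hb := hr.down_pos j
  unfold backwardOp
  rcases lt_trichotomy j 0 with h | h | h
  · have h1 : (j : ℝ) ≤ -1 := by exact_mod_cast Int.le_sub_one_of_lt h
    have := hB j h.le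
    push_cast
    rw [abs_of_nonpos (by linarith), abs_of_nonpos (by linarith), abs_of_nonpos (by linarith)]
    linarith
  · subst h
    have := hB 0 le_rfl
    have := hA 0 le_rfl
    norm_num
    linarith
  · have h1 : (1 : ℝ) ≤ j := by exact_mod_cast h
    have := hA j h.le
    push_cast
    rw [abs_of_nonneg (by linarith), abs_of_nonneg (by linarith), abs_of_nonneg (by linarith)]
    linarith

theorem backwardOp_sub (u v : ℤ → ℝ) (j : ℤ) :
    backwardOp α β (fun i => u i - v i) j = backwardOp α β u j - backwardOp α β v j := by
  unfold backwardOp; ring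

theorem backwardOp_mul (c : ℝ) (v : ℤ → ℝ) (j : ℤ) :
    backwardOp α β (fun i => c * v i) j = c * backwardOp α β v j := by
  unfold backwardOp; ring

theorem backwardOp_const (c : ℝ) (j : ℤ) : backwardOp α β (fun _ => c) j = 0 := by
  unfold backwardOp; ring

/-- The operator is a positive combination of the increments to the two neighbours. At a maximum of
`u - v` the hypotheses hold, so this replaces the second-derivative test. -/
theorem backwardOp_le_of_increments (hr : InwardRates α β) {u v : ℤ → ℝ} {j : ℤ}
    (h1 : u (j - 1) - u j ≤ v (j - 1) - v j) (h2 : u (j + 1) - u j ≤ v (j + 1) - v j) :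
    backwardOp α β u j ≤ backwardOp α β v j := by
  have e : ∀ q : ℤ → ℝ, backwardOp α β q j = β j * (q (j - 1) - q j) + α j * (q (j + 1) - q j) :=
    fun q => by unfold backwardOp; ring
  rw [e, e]
  exact add_le_add (mul_le_mul_of_nonneg_left h1 (hr.down_pos j).le)
    (mul_le_mul_of_nonneg_left h2 (hr.up_pos j).le)

/-- The backward equation at the points of `K`. -/
def SolvesOn (α β : ℤ → ℝ) (K : Finset ℤ) (u : ℝ≥0 → ℤ → ℝ) : Prop :=
  ∀ (t : ℝ≥0), ∀ j ∈ K, HasDerivWithinAt (fun s : ℝ => u s.toNNReal j)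
    (backwardOp α β (u t) j) (Set.Ici 0) (t : ℝ)

theorem IsBackwardSolution.solvesOn {u₀ : ℤ → ℝ} {u : ℝ≥0 → ℤ → ℝ}
    (hu : IsBackwardSolution α β u₀ u) (K : Finset ℤ) : SolvesOn α β K u :=
  fun t j _ => hu.equation t j

theorem SolvesOn.sub {K K' : Finset ℤ} {u v : ℝ≥0 → ℤ → ℝ} (hu : SolvesOn α β K u)
    (hv : SolvesOn α β K' v) (hK : K ⊆ K') : SolvesOn α β K (fun t j => u t j - v t j) := by
  intro t j hj
  rw [backwardOp_sub]
  exact (hu t j hj).sub (hv t j (hK hj))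

theorem SolvesOn.neg {K : Finset ℤ} {u : ℝ≥0 → ℤ → ℝ} (hu : SolvesOn α β K u) :
    SolvesOn α β K (fun t j => - u t j) := by
  intro t j hj
  have e : backwardOp α β (fun i => -u t i) j = - backwardOp α β (u t) j := by
    unfold backwardOp; ring
  rw [e]
  exact (hu t j hj).neg

theorem SolvesOn.sub_const {K : Finset ℤ} {u : ℝ≥0 → ℤ → ℝ} (hu : SolvesOn α β K u) (c : ℝ) :
    SolvesOn α β K (fun t j => u t j - c) := by
  intro t j hj
  rw [backwardOp_sub, backwardOp_const, sub_zero]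
  exact (hu t j hj).sub_const c

/-- Comparison with the barrier `c (|j| + C t)`. -/
theorem SolvesOn.le_barrier (hr : InwardRates α β) {C : ℝ}
    (hC : ∀ j, backwardOp α β (fun i => |(i : ℝ)|) j ≤ C) {K : Finset ℤ} {u : ℝ≥0 → ℤ → ℝ}
    (hu : SolvesOn α β K u) {c : ℝ} (hc : 0 ≤ c) (h0 : ∀ j ∈ K, u 0 j ≤ c * |(j : ℝ)|)
    (hout : ∀ t, ∀ j ∉ K, u t j ≤ c * (|(j : ℝ)| + C * t)) (t : ℝ≥0) (j : ℤ) :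
    u t j ≤ c * (|(j : ℝ)| + C * t) := by
  by_cases hj : j ∈ K
  swap
  · exact hout t j hj
  refine le_of_forall_pos_le_add fun δ hδ => ?_
  -- The extra term `ε * s` makes the inequality at the maximum strict.
  obtain ⟨ε, hε, hεδ⟩ : ∃ ε : ℝ, 0 < ε ∧ ε * t ≤ δ := by
    refine ⟨δ / (t + 1), by positivity, ?_⟩
    rw [div_mul_eq_mul_div, div_le_iff₀ (by positivity)]
    nlinarith [t.coe_nonneg]
  have key := nonpos_of_deriv_neg_at_max K
    (fun s j => u s.toNNReal j - (c * (|(j : ℝ)| + C * s) + ε * s))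
    (fun s j => backwardOp α β (u s.toNNReal) j - (c * (C * 1) + ε * 1)) ?_ ?_ ?_ t t.2 j hj
  · simp only [Real.toNNReal_coe] at key
    linarith
  · intro s hs i hi
    have := hu s.toNNReal i hi
    rw [Real.coe_toNNReal s hs] at this
    exact this.sub (((((hasDerivWithinAt_id s _).const_mul C).const_add _).const_mul c).add
      ((hasDerivWithinAt_id s _).const_mul ε))
  · intro i hi
    simpa using h0 i hi
  · intro s hs i hi hpos hmax
    -- A neighbour of `i` may lie outside `K`; there the difference to the barrier is at most zero,
    -- hence below the positive maximum.
    have hle : ∀ k, u s.toNNReal k - u s.toNNReal i ≤ c * |(k : ℝ)| - c * |(i : ℝ)| := by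
      intro k
      by_cases hk : k ∈ K
      · have := hmax k hk
        linarith
      · have := hout s.toNNReal k hk
        rw [Real.coe_toNNReal s hs.le] at this
        have h2 : 0 ≤ ε * s := by positivity
        linarith
    have := backwardOp_le_of_increments hr (v := fun k => c * |(k : ℝ)|) (hle (i - 1)) (hle (i + 1))
    rw [backwardOp_mul] at this
    have h3 := mul_le_mul_of_nonneg_left (hC i) hc
    linarith

theorem SolvesOn.nonpos (hr : InwardRates α β) {K : Finset ℤ} {u : ℝ≥0 → ℤ → ℝ}
    (hu : SolvesOn α β K u) (h0 : ∀ j ∈ K, u 0 j ≤ 0) (hout : ∀ t, ∀ j ∉ K, u t j ≤ 0)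
    (t : ℝ≥0) (j : ℤ) : u t j ≤ 0 := by
  obtain ⟨C, -, hC⟩ := hr.exists_drift_bound
  simpa using hu.le_barrier hr hC le_rfl (by simpa using h0) (by simpa using hout) t j

theorem exists_abs_gt_of_notMem (B : ℝ) {ε : ℝ} (hε : 0 < ε) :
    ∃ N : ℕ, ∀ j : ℤ, j ∉ Finset.Icc (-(N : ℤ)) N → B ≤ ε * |(j : ℝ)| := by
  obtain ⟨N, hN⟩ := exists_nat_ge (B / ε)
  refine ⟨N, fun j hj => ?_⟩
  have h1 : (N : ℤ) ≤ |j| := by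
    by_contra! h
    rw [abs_lt] at h
    exact hj (Finset.mem_Icc.mpr ⟨h.1.le, h.2.le⟩)
  have h2 : (N : ℝ) ≤ |(j : ℝ)| := by exact_mod_cast h1
  rw [div_le_iff₀ hε] at hN
  nlinarith

/-- A Phragmén–Lindelöf argument: raising `c` by `ε` lifts the barrier above the global bound of `u`
outside a finite interval, where the finite version applies; then `ε` tends to zero. -/
theorem IsBackwardSolution.le_barrier (hr : InwardRates α β) {C : ℝ} (hC0 : 0 ≤ C)
    (hC : ∀ j, backwardOp α β (fun i => |(i : ℝ)|) j ≤ C) {u₀ : ℤ → ℝ} {u : ℝ≥0 → ℤ → ℝ}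
    (hu : IsBackwardSolution α β u₀ u) {c : ℝ} (hc : 0 ≤ c) (h0 : ∀ j, u₀ j ≤ c * |(j : ℝ)|)
    (t : ℝ≥0) (j : ℤ) : u t j ≤ c * (|(j : ℝ)| + C * t) := by
  obtain ⟨B, hB⟩ := hu.bounded
  refine le_of_forall_pos_le_add fun δ hδ => ?_
  have hV : 0 ≤ |(j : ℝ)| + C * t := by positivity
  obtain ⟨ε, hε, hεδ⟩ : ∃ ε : ℝ, 0 < ε ∧ ε * (|(j : ℝ)| + C * t) ≤ δ := by
    refine ⟨δ / (|(j : ℝ)| + C * t + 1), by positivity, ?_⟩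
    rw [div_mul_eq_mul_div, div_le_iff₀ (by positivity)]
    nlinarith
  obtain ⟨N, hN⟩ := exists_abs_gt_of_notMem B hε
  have := (hu.solvesOn (Finset.Icc (-(N : ℤ)) N)).le_barrier hr hC (c := c + ε) (by positivity)
    (fun i _ => by
      rw [hu.initial]
      nlinarith [h0 i, abs_nonneg (i : ℝ)])
    (fun s i hi => by
      have h1 := (le_abs_self _).trans (hB s i)
      have h2 := hN i hi
      have h3 : 0 ≤ C * (s : ℝ) := by positivity
      nlinarith [abs_nonneg (i : ℝ), mul_nonneg hc (abs_nonneg (i : ℝ))]) t j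
  linarith

theorem IsBackwardSolution.sub {u₀ v₀ : ℤ → ℝ} {u v : ℝ≥0 → ℤ → ℝ}
    (hu : IsBackwardSolution α β u₀ u) (hv : IsBackwardSolution α β v₀ v) :
    IsBackwardSolution α β (fun j => u₀ j - v₀ j) (fun t j => u t j - v t j) where
  initial := by rw [hu.initial, hv.initial]
  bounded := by
    obtain ⟨B, hB⟩ := hu.bounded
    obtain ⟨B', hB'⟩ := hv.bounded
    exact ⟨B + B', fun t j => (abs_sub _ _).trans (add_le_add (hB t j) (hB' t j))⟩
  equation t j := by
    rw [backwardOp_sub]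
    exact (hu.equation t j).sub (hv.equation t j)

theorem IsBackwardSolution.const (c : ℝ) :
    IsBackwardSolution α β (fun _ => c) (fun _ _ => c) where
  initial := rfl
  bounded := ⟨|c|, fun _ _ => le_rfl⟩
  equation t j := by
    rw [backwardOp_const]
    exact hasDerivWithinAt_const _ _ _

theorem IsBackwardSolution.mul {u₀ : ℤ → ℝ} {u : ℝ≥0 → ℤ → ℝ}
    (hu : IsBackwardSolution α β u₀ u) (c : ℝ) :
    IsBackwardSolution α β (fun j => c * u₀ j) (fun t j => c * u t j) where
  initial := by rw [hu.initial]
  bounded := by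
    obtain ⟨B, hB⟩ := hu.bounded
    exact ⟨|c| * B, fun t j => by
      rw [abs_mul]; exact mul_le_mul_of_nonneg_left (hB t j) (abs_nonneg c)⟩
  equation t j := by
    rw [backwardOp_mul]
    exact (hu.equation t j).const_mul c

theorem IsBackwardSolution.add {u₀ v₀ : ℤ → ℝ} {u v : ℝ≥0 → ℤ → ℝ}
    (hu : IsBackwardSolution α β u₀ u) (hv : IsBackwardSolution α β v₀ v) :
    IsBackwardSolution α β (fun j => u₀ j + v₀ j) (fun t j => u t j + v t j) := by
  simpa using hu.sub (hv.mul (-1))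

theorem IsBackwardSolution.sum {ι : Type*} (F : Finset ι) {u₀ : ι → ℤ → ℝ} {u : ι → ℝ≥0 → ℤ → ℝ}
    (hu : ∀ i, IsBackwardSolution α β (u₀ i) (u i)) :
    IsBackwardSolution α β (fun j => ∑ i ∈ F, u₀ i j) (fun t j => ∑ i ∈ F, u i t j) := by
  classical
  induction F using Finset.induction_on with
  | empty => simpa using IsBackwardSolution.const 0
  | insert i F hi ih => simpa [Finset.sum_insert hi] using (hu i).add ih

theorem IsBackwardSolution.shift {u₀ : ℤ → ℝ} {u : ℝ≥0 → ℤ → ℝ}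
    (hu : IsBackwardSolution α β u₀ u) (s : ℝ≥0) :
    IsBackwardSolution α β (u s) (fun t => u (t + s)) where
  initial := by rw [zero_add]
  bounded := by
    obtain ⟨B, hB⟩ := hu.bounded
    exact ⟨B, fun t j => hB _ j⟩
  equation t j := by
    have h1 := hu.equation (t + s) j
    rw [NNReal.coe_add] at h1
    have h2 : HasDerivWithinAt (fun r : ℝ => r + s) 1 (Set.Ici 0) t :=
      (hasDerivWithinAt_id _ _).add_const _
    have h3 := HasDerivWithinAt.scomp (t : ℝ) h1 h2 (t' := Set.Ici 0) (fun r hr => by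
      have : (0 : ℝ) ≤ r := hr
      show (0 : ℝ) ≤ r + s
      positivity)
    rw [one_smul] at h3
    refine h3.congr (fun r hr => ?_) ?_
    · rw [Function.comp_apply, Real.toNNReal_add hr s.coe_nonneg, Real.toNNReal_coe]
    · simp

theorem IsBackwardSolution.nonpos (hr : InwardRates α β) {u₀ : ℤ → ℝ} {u : ℝ≥0 → ℤ → ℝ}
    (hu : IsBackwardSolution α β u₀ u) (h0 : ∀ j, u₀ j ≤ 0) (t : ℝ≥0) (j : ℤ) : u t j ≤ 0 := by
  obtain ⟨C, hC0, hC⟩ := hr.exists_drift_bound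
  simpa using hu.le_barrier hr hC0 hC le_rfl (by simpa using h0) t j

theorem IsBackwardSolution.mono (hr : InwardRates α β) {u₀ v₀ : ℤ → ℝ} {u v : ℝ≥0 → ℤ → ℝ}
    (hu : IsBackwardSolution α β u₀ u) (hv : IsBackwardSolution α β v₀ v)
    (h0 : ∀ j, u₀ j ≤ v₀ j) (t : ℝ≥0) (j : ℤ) : u t j ≤ v t j :=
  sub_nonpos.mp ((hu.sub hv).nonpos hr (fun j => sub_nonpos.mpr (h0 j)) t j)

theorem IsBackwardSolution.unique (hr : InwardRates α β) {u₀ : ℤ → ℝ} {u v : ℝ≥0 → ℤ → ℝ}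
    (hu : IsBackwardSolution α β u₀ u) (hv : IsBackwardSolution α β u₀ v) : u = v :=
  funext₂ fun t j => le_antisymm (hu.mono hr hv (fun _ => le_rfl) t j)
    (hv.mono hr hu (fun _ => le_rfl) t j)

/-- Doubling of variables: `u t i - u t j` on pairs `i ≤ j` solves the equation of two independent
chains and vanishes on the diagonal. Jumps move one coordinate by one step, so ordered chains must
meet before crossing. The barrier is `|i| + |j| + (2C + 1) t`, with `2C` for the two drifts and `1`
for strictness. -/
theorem IsBackwardSolution.monotone (hr : InwardRates α β) {u₀ : ℤ → ℝ} {u : ℝ≥0 → ℤ → ℝ}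
    (hu : IsBackwardSolution α β u₀ u) (h0 : Monotone u₀) (t : ℝ≥0) : Monotone (u t) := by
  obtain ⟨C, hC0, hC⟩ := hr.exists_drift_bound
  obtain ⟨B, hB⟩ := hu.bounded
  intro i j hij
  rw [← sub_nonpos]
  refine le_of_forall_pos_le_add fun δ hδ => ?_
  set D : ℝ := |(i : ℝ)| + |(j : ℝ)| + (2 * C + 1) * t with hD
  have hD0 : 0 ≤ D := by positivity
  obtain ⟨ε, hε, hεδ⟩ : ∃ ε : ℝ, 0 < ε ∧ ε * D ≤ δ := by
    refine ⟨δ / (D + 1), by positivity, ?_⟩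
    rw [div_mul_eq_mul_div, div_le_iff₀ (by positivity)]
    nlinarith
  obtain ⟨N, hN⟩ := exists_abs_gt_of_notMem (B + B) hε
  have hdiff : ∀ s k l, u s k - u s l ≤ B + B := fun s k l =>
    (le_abs_self _).trans ((abs_sub _ _).trans (add_le_add (hB s k) (hB s l)))
  set K : Finset (ℤ × ℤ) :=
    ((Finset.Icc (-(N : ℤ)) N) ×ˢ (Finset.Icc (-(N : ℤ)) N)).filter (fun x => x.1 ≤ x.2) with hK
  have hmem : ∀ k l, k ≤ l → (k, l) ∉ K → ∀ s, u s k - u s l ≤ ε * (|(k : ℝ)| + |(l : ℝ)|) := by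
    intro k l hkl hkl' s
    have h1 := hdiff s k l
    by_cases hk : k ∈ Finset.Icc (-(N : ℤ)) N
    · have hl : l ∉ Finset.Icc (-(N : ℤ)) N := fun hl => hkl' (by
        rw [hK, Finset.mem_filter, Finset.mem_product]
        exact ⟨⟨hk, hl⟩, hkl⟩)
      have := hN l hl
      nlinarith [abs_nonneg (k : ℝ)]
    · have := hN k hk
      nlinarith [abs_nonneg (l : ℝ)]
  suffices h : u t i - u t j - ε * D ≤ 0 by linarith
  by_cases hx : (i, j) ∈ K
  swap
  · have := hmem i j hij hx t
    have h2 : 0 ≤ (2 * C + 1) * (t : ℝ) := by positivity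
    rw [hD]
    nlinarith
  have key := nonpos_of_deriv_neg_at_max K
    (fun s x => (u s.toNNReal x.1 - u s.toNNReal x.2)
      - ε * (|(x.1 : ℝ)| + |(x.2 : ℝ)| + (2 * C + 1) * s))
    (fun s x => (backwardOp α β (u s.toNNReal) x.1 - backwardOp α β (u s.toNNReal) x.2)
      - ε * ((2 * C + 1) * 1)) ?_ ?_ ?_ t t.2 (i, j) hx
  · simpa only [Real.toNNReal_coe] using key
  · intro s hs x _
    have h1 := hu.equation s.toNNReal x.1
    have h2 := hu.equation s.toNNReal x.2
    rw [Real.coe_toNNReal s hs] at h1 h2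
    exact (h1.sub h2).sub ((((hasDerivWithinAt_id s _).const_mul _).const_add _).const_mul ε)
  · intro x hx
    have := h0 (Finset.mem_filter.mp hx).2
    simp only [Real.toNNReal_zero, hu.initial, mul_zero, add_zero]
    have h2 : 0 ≤ ε * (|(x.1 : ℝ)| + |(x.2 : ℝ)|) := by positivity
    linarith
  · rintro s hs ⟨k, l⟩ hx hpos hmax
    simp only at hpos hmax
    have hkl : k ≤ l := (Finset.mem_filter.mp hx).2
    have hs2 : 0 ≤ ε * ((2 * C + 1) * s) := by positivity
    -- Off the diagonal, all four neighbouring pairs are still ordered.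
    have hne : k ≠ l := by
      rintro rfl
      have : 0 ≤ ε * (|(k : ℝ)| + |(k : ℝ)|) := by positivity
      linarith
    have hlt : k < l := lt_of_le_of_ne hkl hne
    have hle : ∀ k' l', k' ≤ l' →
        (u s.toNNReal k' - u s.toNNReal l') - (u s.toNNReal k - u s.toNNReal l) ≤
          ε * (|(k' : ℝ)| + |(l' : ℝ)|) - ε * (|(k : ℝ)| + |(l : ℝ)|) := by
      intro k' l' h
      by_cases hx' : (k', l') ∈ K
      · have := hmax (k', l') hx'
        simp only at this
        linarith
      · have := hmem k' l' h hx' s.toNNReal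
        linarith
    have e1 := hle (k - 1) l (by omega)
    have e2 := hle (k + 1) l (by omega)
    have e3 := hle k (l - 1) (by omega)
    have e4 := hle k (l + 1) (by omega)
    have f1 := backwardOp_le_of_increments hr (u := u s.toNNReal) (j := k)
      (v := fun k => ε * |(k : ℝ)|) (by linarith) (by linarith)
    have f2 := backwardOp_le_of_increments hr (u := fun m => -1 * u s.toNNReal m) (j := l)
      (v := fun k => ε * |(k : ℝ)|) (by linarith) (by linarith)
    rw [backwardOp_mul] at f1 f2
    rw [backwardOp_mul] at f2
    have g1 := mul_le_mul_of_nonneg_left (hC k) hε.le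
    have g2 := mul_le_mul_of_nonneg_left (hC l) hε.le
    simp only
    linarith


/-! ### Existence of bounded solutions by truncation -/

/-- To the left of `t` the forward expansion is taken at the earlier time, and the uniform
continuity of `f'` moves the slope to `t`. Thus uniform forward estimates suffice for the two-sided
derivative. -/
theorem hasDerivWithinAt_of_uniform_increments {f f' : ℝ≥0 → ℝ}
    (hcont : ∀ ε > 0, ∃ δ > 0, ∀ s r : ℝ≥0, (r : ℝ) < δ → |f' (s + r) - f' s| ≤ ε)
    (hinc : ∀ ε > 0, ∃ δ > 0, ∀ s r : ℝ≥0, (r : ℝ) < δ → |f (s + r) - f s - r * f' s| ≤ ε * r)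
    (t : ℝ≥0) : HasDerivWithinAt (fun s : ℝ => f s.toNNReal) (f' t) (Set.Ici 0) t := by
  rw [hasDerivWithinAt_iff_isLittleO, Asymptotics.isLittleO_iff]
  intro c hc
  obtain ⟨δ₁, hδ₁, h1⟩ := hcont (c / 2) (by positivity)
  obtain ⟨δ₂, hδ₂, h2⟩ := hinc (c / 2) (by positivity)
  have hball : ∀ᶠ s : ℝ in 𝓝[Set.Ici 0] (t : ℝ), |s - t| < min δ₁ δ₂ :=
    mem_nhdsWithin_of_mem_nhds (Metric.ball_mem_nhds (t : ℝ) (lt_min hδ₁ hδ₂))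
  filter_upwards [hball, self_mem_nhdsWithin] with s hs hs0
  lift s to ℝ≥0 using hs0
  simp only [Real.toNNReal_coe, smul_eq_mul, Real.norm_eq_abs]
  rcases le_total t s with hts | hts
  · obtain ⟨r, rfl⟩ := exists_add_of_le hts
    have e : ((t + r : ℝ≥0) : ℝ) - t = r := by push_cast; ring
    rw [e] at hs ⊢
    rw [abs_of_nonneg r.coe_nonneg] at hs ⊢
    refine (h2 t r (hs.trans_le (min_le_right _ _))).trans ?_
    nlinarith [r.coe_nonneg]
  · obtain ⟨r, rfl⟩ := exists_add_of_le hts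
    have e : (s : ℝ) - (s + r : ℝ≥0) = -r := by push_cast; ring
    rw [e] at hs ⊢
    rw [abs_neg, abs_of_nonneg r.coe_nonneg] at hs ⊢
    have a1 := h1 s r (hs.trans_le (min_le_left _ _))
    have a2 := h2 s r (hs.trans_le (min_le_right _ _))
    have e2 : f s - f (s + r) - -r * f' (s + r) =
      -(f (s + r) - f s - r * f' s) + r * (f' (s + r) - f' s) := by ring
    rw [e2]
    refine (abs_add_le _ _).trans ?_
    rw [abs_neg, abs_mul, abs_of_nonneg r.coe_nonneg]
    have := mul_le_mul_of_nonneg_left a1 r.coe_nonneg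
    linarith

theorem abs_backwardOp_sub_le (hr : InwardRates α β) {u v : ℤ → ℝ} {j : ℤ} {a b c : ℝ}
    (ha : |u (j - 1) - v (j - 1)| ≤ a) (hb : |u j - v j| ≤ b) (hc : |u (j + 1) - v (j + 1)| ≤ c) :
    |backwardOp α β u j - backwardOp α β v j| ≤ β j * a + (α j + β j) * b + α j * c := by
  have hα := hr.up_pos j
  have hβ := hr.down_pos j
  have e : backwardOp α β u j - backwardOp α β v j = β j * (u (j - 1) - v (j - 1))
      + -((α j + β j) * (u j - v j)) + α j * (u (j + 1) - v (j + 1)) := by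
    unfold backwardOp; ring
  rw [e]
  refine (abs_add_three _ _ _).trans ?_
  rw [abs_neg, abs_mul, abs_mul, abs_mul, abs_of_pos hα, abs_of_pos hβ,
    abs_of_pos (add_pos hα hβ)]
  gcongr

/-- A bounded family which solves the backward equation on finite sets is locally uniformly
differentiable in time. -/
theorem SolvesOn.abs_increment_le (hr : InwardRates α β) {K : Finset ℤ} {u : ℝ≥0 → ℤ → ℝ}
    (hu : SolvesOn α β K u) {B : ℝ} (hB : ∀ t j, |u t j| ≤ B) {j : ℤ} (hj : j ∈ K) (s r : ℝ≥0) :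
    |u (s + r) j - u s j| ≤ 2 * (α j + β j) * B * r := by
  have hα := hr.up_pos j
  have hβ := hr.down_pos j
  have h := Convex.norm_image_sub_le_of_norm_hasDerivWithin_le (s := Set.Ici (0 : ℝ))
    (f := fun x : ℝ => u x.toNNReal j) (f' := fun x => backwardOp α β (u x.toNNReal) j)
    (C := 2 * (α j + β j) * B) (x := (s : ℝ)) (y := ((s + r : ℝ≥0) : ℝ))
    (fun x hx => by
      have := hu x.toNNReal j hj
      rwa [Real.coe_toNNReal x hx] at this)
    (fun x _ => by
      have := abs_backwardOp_sub_le hr (u := u x.toNNReal) (v := fun _ => 0) (j := j)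
        (by simpa using hB _ _) (by simpa using hB _ _) (by simpa using hB _ _)
      rw [backwardOp_const, sub_zero] at this
      rw [Real.norm_eq_abs]
      refine this.trans (le_of_eq ?_)
      ring)
    (convex_Ici 0) s.2 (s + r).2
  simpa [abs_of_nonneg r.coe_nonneg] using h

/-- The time derivative is Lipschitz because the three entries in it are; the mean value inequality
then gives a quadratic remainder. The constant does not depend on `K`, so the estimate survives
pointwise limits. -/
theorem SolvesOn.abs_taylor_le (hr : InwardRates α β) {K : Finset ℤ} {u : ℝ≥0 → ℤ → ℝ}
    (hu : SolvesOn α β K u) {B : ℝ} (hB : ∀ t j, |u t j| ≤ B) {j : ℤ} (hj0 : j - 1 ∈ K)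
    (hj : j ∈ K) (hj1 : j + 1 ∈ K) (s r : ℝ≥0) :
    |u (s + r) j - u s j - r * backwardOp α β (u s) j| ≤
      (β j * (2 * (α (j - 1) + β (j - 1)) * B) + (α j + β j) * (2 * (α j + β j) * B)
        + α j * (2 * (α (j + 1) + β (j + 1)) * B)) * r * r := by
  set D := (β j * (2 * (α (j - 1) + β (j - 1)) * B) + (α j + β j) * (2 * (α j + β j) * B)
        + α j * (2 * (α (j + 1) + β (j + 1)) * B)) with hD
  have hB0 : 0 ≤ B := (abs_nonneg _).trans (hB 0 0)
  have hα := hr.up_pos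
  have hβ := hr.down_pos
  have hD0 : 0 ≤ D := by
    have := (hα j).le; have := (hβ j).le; have := (hα (j - 1)).le; have := (hβ (j - 1)).le
    have := (hα (j + 1)).le; have := (hβ (j + 1)).le
    positivity
  have h := Convex.norm_image_sub_le_of_norm_hasDerivWithin_le
    (s := Set.Icc (s : ℝ) ((s + r : ℝ≥0) : ℝ))
    (f := fun x : ℝ => u x.toNNReal j - x * backwardOp α β (u s) j)
    (f' := fun x => backwardOp α β (u x.toNNReal) j - 1 * backwardOp α β (u s) j)
    (C := D * r) (x := (s : ℝ)) (y := ((s + r : ℝ≥0) : ℝ))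
    (fun x hx => by
      have hx0 : 0 ≤ x := s.coe_nonneg.trans hx.1
      have := hu x.toNNReal j hj
      rw [Real.coe_toNNReal x hx0] at this
      exact (this.sub ((hasDerivWithinAt_id x _).mul_const _)).mono
        (fun y hy => s.coe_nonneg.trans hy.1))
    (fun x hx => by
      have hx0 : 0 ≤ x := s.coe_nonneg.trans hx.1
      lift x to ℝ≥0 using hx0
      obtain ⟨q, rfl⟩ := exists_add_of_le (NNReal.coe_le_coe.mp hx.1)
      have hq : (q : ℝ) ≤ r := by
        have := hx.2
        push_cast at this
        linarith
      rw [Real.toNNReal_coe, one_mul, Real.norm_eq_abs]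
      refine (abs_backwardOp_sub_le hr (hu.abs_increment_le hr hB hj0 s q)
        (hu.abs_increment_le hr hB hj s q) (hu.abs_increment_le hr hB hj1 s q)).trans ?_
      refine le_trans (le_of_eq ?_) (mul_le_mul_of_nonneg_left hq hD0)
      rw [hD]
      ring)
    (convex_Icc _ _) (by simp) (by simp)
  have e : u (s + r) j - u s j - r * backwardOp α β (u s) j =
      u (s + r) j - (s + r) * backwardOp α β (u s) j - (u s j - s * backwardOp α β (u s) j) := by
    ring
  rw [e]
  simpa [abs_of_nonneg r.coe_nonneg] using h

/-- Pointwise limits of local solutions are solutions. -/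
theorem IsBackwardSolution.of_tendsto (hr : InwardRates α β) {u₀ : ℤ → ℝ}
    {v : ℕ → ℝ≥0 → ℤ → ℝ} {u : ℝ≥0 → ℤ → ℝ} {B : ℝ} (hB : ∀ n t j, |v n t j| ≤ B)
    (hv : ∀ n : ℕ, SolvesOn α β (Finset.Icc (-(n : ℤ)) n) (v n))
    (hlim : ∀ t j, Tendsto (fun n => v n t j) atTop (𝓝 (u t j))) (h0 : u 0 = u₀) :
    IsBackwardSolution α β u₀ u where
  initial := h0
  bounded := ⟨B, fun t j => le_of_tendsto (hlim t j).abs (Eventually.of_forall fun n => hB n t j)⟩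
  equation := by
    have hB0 : 0 ≤ B := (abs_nonneg _).trans (hB 0 0 0)
    have hα := hr.up_pos
    have hβ := hr.down_pos
    have hmem : ∀ j : ℤ, ∀ᶠ n : ℕ in atTop, j ∈ Finset.Icc (-(n : ℤ)) n := by
      intro j
      filter_upwards [eventually_ge_atTop j.natAbs] with n hn
      rw [Finset.mem_Icc]
      omega
    have hL : ∀ t j, Tendsto (fun n => backwardOp α β (v n t) j) atTop
        (𝓝 (backwardOp α β (u t) j)) := fun t j =>
      (((hlim t (j - 1)).const_mul _).sub ((hlim t j).const_mul _)).add
        ((hlim t (j + 1)).const_mul _)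
    have hlip : ∀ j s r, |u (s + r) j - u s j| ≤ 2 * (α j + β j) * B * r := by
      intro j s r
      refine le_of_tendsto ((hlim (s + r) j).sub (hlim s j)).abs ?_
      filter_upwards [hmem j] with n hn
      exact (hv n).abs_increment_le hr (hB n) hn s r
    intro t j
    obtain ⟨D, hD0, hD⟩ : ∃ D, 0 ≤ D ∧
        (β j * (2 * (α (j - 1) + β (j - 1)) * B) + (α j + β j) * (2 * (α j + β j) * B)
        + α j * (2 * (α (j + 1) + β (j + 1)) * B)) = D := by
      refine ⟨_, ?_, rfl⟩
      have := (hα j).le; have := (hβ j).le; have := (hα (j - 1)).le; have := (hβ (j - 1)).le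
      have := (hα (j + 1)).le; have := (hβ (j + 1)).le
      positivity
    have hsmall : ∀ ε > 0, ∀ r : ℝ≥0, (r : ℝ) < ε / (D + 1) → D * r ≤ ε := by
      intro ε hε r h
      rw [lt_div_iff₀ (by positivity)] at h
      nlinarith [r.coe_nonneg]
    refine hasDerivWithinAt_of_uniform_increments (f := fun t => u t j)
      (f' := fun t => backwardOp α β (u t) j)
      (fun ε hε => ⟨ε / (D + 1), by positivity, fun s r h => ?_⟩)
      (fun ε hε => ⟨ε / (D + 1), by positivity, fun s r h => ?_⟩) t
    · refine (abs_backwardOp_sub_le hr (hlip _ s r) (hlip _ s r) (hlip _ s r)).trans ?_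
      refine le_trans (le_of_eq ?_) (hsmall ε hε r h)
      rw [← hD]
      ring
    · refine le_trans ?_ (mul_le_mul_of_nonneg_right (hsmall ε hε r h) r.coe_nonneg)
      refine le_of_tendsto (((hlim (s + r) j).sub (hlim s j)).sub ((hL s j).const_mul _)).abs ?_
      filter_upwards [hmem j, hmem (j - 1), hmem (j + 1)] with n h1 h2 h3
      rw [← hD]
      exact (hv n).abs_taylor_le hr (hB n) h2 h1 h3 s r

/-- The matrix of jump rates restricted to `[-N, N]`. -/
def dirichletMatrix (α β : ℤ → ℝ) (N : ℕ) :
    Matrix (Finset.Icc (-(N : ℤ)) N) (Finset.Icc (-(N : ℤ)) N) ℝ :=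
  Matrix.of fun i j => rateMatrix α β i j

/-- The solution of the backward equation on `[-N, N]` which vanishes outside. -/
noncomputable def dirichletSolution (α β : ℤ → ℝ) (N : ℕ) (u₀ : ℤ → ℝ) (t : ℝ≥0) (j : ℤ) : ℝ :=
  if hj : j ∈ Finset.Icc (-(N : ℤ)) N then
    (NormedSpace.exp ((t : ℝ) • dirichletMatrix α β N)).mulVec (fun i => u₀ i) ⟨j, hj⟩
  else 0

/-- Functions vanishing outside `K` lose nothing under truncation, so the finite linear system is
the exact backward equation on `K`. -/
theorem sum_rateMatrix_mul (K : Finset ℤ) (f : ℤ → ℝ) (hf : ∀ j ∉ K, f j = 0) (j : ℤ) :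
    ∑ k ∈ K, rateMatrix α β j k * f k = backwardOp α β f j := by
  have e : ∀ k, rateMatrix α β j k * f k = (if k = j + 1 then α j * f k else 0)
      + (if k = j - 1 then β j * f k else 0) + (if k = j then -(α j + β j) * f k else 0) := by
    intro k
    unfold rateMatrix
    by_cases h1 : k = j + 1
    · rw [if_pos h1, if_pos h1, if_neg (by omega), if_neg (by omega)]
      ring
    · by_cases h2 : k = j - 1
      · rw [if_neg h1, if_neg h1, if_pos h2, if_pos h2, if_neg (by omega)]
        ring
      · rw [if_neg h1, if_neg h1, if_neg h2, if_neg h2]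
        split_ifs <;> ring
  simp only [e, Finset.sum_add_distrib, Finset.sum_ite_eq']
  have h : ∀ (c : ℝ) k, (if k ∈ K then c * f k else 0) = c * f k := by
    intro c k
    split_ifs with hk
    · rfl
    · rw [hf k hk, mul_zero]
  rw [h, h, h]
  unfold backwardOp
  ring

open scoped Matrix.Norms.Operator in
theorem dirichletSolution_solvesOn (α β : ℤ → ℝ) (N : ℕ) (u₀ : ℤ → ℝ) :
    SolvesOn α β (Finset.Icc (-(N : ℤ)) N) (dirichletSolution α β N u₀) := by
  intro t j hj
  set A := dirichletMatrix α β N with hA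
  set v : Finset.Icc (-(N : ℤ)) N → ℝ := fun i => u₀ i with hv
  let ℓ : Matrix (Finset.Icc (-(N : ℤ)) N) (Finset.Icc (-(N : ℤ)) N) ℝ →ₗ[ℝ] ℝ :=
    { toFun := fun M => M.mulVec v ⟨j, hj⟩
      map_add' := fun M M' => by simp [Matrix.add_mulVec]
      map_smul' := fun c M => by simp [Matrix.smul_mulVec] }
  have h1 : HasDerivAt (fun s : ℝ => (NormedSpace.exp (s • A)))
      (A * NormedSpace.exp ((t : ℝ) • A)) (t : ℝ) := hasDerivAt_exp_smul_const' A (t : ℝ)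
  have h2 : HasDerivWithinAt (fun s : ℝ => (NormedSpace.exp (s • A)).mulVec v ⟨j, hj⟩)
      ((A * NormedSpace.exp ((t : ℝ) • A)).mulVec v ⟨j, hj⟩) (Set.Ici 0) (t : ℝ) :=
    (ℓ.toContinuousLinearMap.hasFDerivAt.comp_hasDerivAt (t : ℝ) h1).hasDerivWithinAt
  have e : (A * NormedSpace.exp ((t : ℝ) • A)).mulVec v ⟨j, hj⟩ =
      backwardOp α β (dirichletSolution α β N u₀ t) j := by
    rw [← Matrix.mulVec_mulVec, ← sum_rateMatrix_mul (Finset.Icc (-(N : ℤ)) N)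
      (dirichletSolution α β N u₀ t) (fun i hi => dif_neg hi),
      ← Finset.sum_coe_sort (Finset.Icc (-(N : ℤ)) N)
        (fun k => rateMatrix α β j k * dirichletSolution α β N u₀ t k)]
    show ∑ i, A ⟨j, hj⟩ i * (NormedSpace.exp ((t : ℝ) • A)).mulVec v i = _
    refine Finset.sum_congr rfl fun i _ => ?_
    rw [dirichletSolution, dif_pos i.2]
    rfl
  rw [e] at h2
  refine h2.congr (fun s hs => ?_) ?_
  · rw [dirichletSolution, dif_pos hj, Real.coe_toNNReal s hs]
  · rw [dirichletSolution, dif_pos hj, Real.toNNReal_coe]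

theorem dirichletSolution_zero_time {N : ℕ} {j : ℤ} (hj : j ∈ Finset.Icc (-(N : ℤ)) N)
    (u₀ : ℤ → ℝ) : dirichletSolution α β N u₀ 0 j = u₀ j := by
  simp [dirichletSolution, hj]

theorem dirichletSolution_of_notMem {N : ℕ} {j : ℤ} (hj : j ∉ Finset.Icc (-(N : ℤ)) N)
    (u₀ : ℤ → ℝ) (t : ℝ≥0) : dirichletSolution α β N u₀ t j = 0 := dif_neg hj

theorem abs_dirichletSolution_le (hr : InwardRates α β) {u₀ : ℤ → ℝ} {B : ℝ}
    (hB : ∀ j, |u₀ j| ≤ B) (N : ℕ) (t : ℝ≥0) (j : ℤ) : |dirichletSolution α β N u₀ t j| ≤ B := by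
  have hB0 : 0 ≤ B := (abs_nonneg _).trans (hB 0)
  rw [abs_le']
  constructor
  · have := ((dirichletSolution_solvesOn α β N u₀).sub_const B).nonpos hr
      (fun i hi => by
        rw [dirichletSolution_zero_time hi]
        linarith [(abs_le.mp (hB i)).2])
      (fun s i hi => by
        rw [dirichletSolution_of_notMem hi]
        linarith) t j
    linarith
  · have := ((dirichletSolution_solvesOn α β N u₀).neg.sub_const B).nonpos hr
      (fun i hi => by
        rw [dirichletSolution_zero_time hi]
        linarith [(abs_le.mp (hB i)).1])
      (fun s i hi => by
        rw [dirichletSolution_of_notMem hi]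
        linarith) t j
    linarith

theorem abs_ge_of_notMem_Icc {N : ℕ} {j : ℤ} (hj : j ∉ Finset.Icc (-(N : ℤ)) N) :
    (N : ℝ) + 1 ≤ |(j : ℝ)| := by
  have h1 : (N : ℤ) + 1 ≤ |j| := by
    by_contra! h
    rw [Int.lt_add_one_iff, abs_le] at h
    exact hj (Finset.mem_Icc.mpr h)
  exact_mod_cast h1

/-- Both truncations solve the equation on the smaller interval with equal initial values. Outside
it they differ by at most `2 * B`, which is below the barrier since `|j| ≥ N + 1` there. -/
theorem dirichletSolution_sub_le (hr : InwardRates α β) {C : ℝ} (hC0 : 0 ≤ C)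
    (hC : ∀ j, backwardOp α β (fun i => |(i : ℝ)|) j ≤ C) {u₀ : ℤ → ℝ} {B : ℝ}
    (hB : ∀ j, |u₀ j| ≤ B) {N M : ℕ} (hNM : N ≤ M) (t : ℝ≥0) (j : ℤ) :
    |dirichletSolution α β M u₀ t j - dirichletSolution α β N u₀ t j| ≤
      2 * B / (N + 1) * (|(j : ℝ)| + C * t) := by
  have hB0 : 0 ≤ B := (abs_nonneg _).trans (hB 0)
  have hsub : Finset.Icc (-(N : ℤ)) N ⊆ Finset.Icc (-(M : ℤ)) M := by
    intro i hi
    rw [Finset.mem_Icc] at hi ⊢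
    omega
  have hs := (dirichletSolution_solvesOn α β N u₀)
  have hs' := (dirichletSolution_solvesOn α β M u₀)
  have hs'' : SolvesOn α β (Finset.Icc (-(N : ℤ)) N) (dirichletSolution α β M u₀) :=
    fun t j hj => hs' t j (hsub hj)
  have hc : 0 ≤ 2 * B / ((N : ℝ) + 1) := by positivity
  have hout : ∀ (t : ℝ≥0) (i : ℤ), i ∉ Finset.Icc (-(N : ℤ)) N →
      |dirichletSolution α β M u₀ t i - dirichletSolution α β N u₀ t i| ≤
        2 * B / (N + 1) * (|(i : ℝ)| + C * t) := by
    intro t i hi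
    have h1 : 2 * B ≤ 2 * B / ((N : ℝ) + 1) * |(i : ℝ)| := by
      rw [div_mul_eq_mul_div, le_div_iff₀ (by positivity)]
      exact mul_le_mul_of_nonneg_left (abs_ge_of_notMem_Icc hi) (by positivity)
    have h2 : 0 ≤ 2 * B / ((N : ℝ) + 1) * (C * t) := by positivity
    have h3 := abs_sub (dirichletSolution α β M u₀ t i) (dirichletSolution α β N u₀ t i)
    have h4 := abs_dirichletSolution_le hr hB M t i
    have h5 := abs_dirichletSolution_le hr hB N t i
    linarith
  rw [abs_le']
  constructor
  · refine (hs''.sub hs subset_rfl).le_barrier hr hC hc (fun i hi => ?_)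
      (fun t i hi => (le_abs_self _).trans (hout t i hi)) t j
    rw [dirichletSolution_zero_time (hsub hi), dirichletSolution_zero_time hi, sub_self]
    positivity
  · rw [neg_sub]
    refine (hs.sub hs'' subset_rfl).le_barrier hr hC hc (fun i hi => ?_)
      (fun t i hi => ?_) t j
    · rw [dirichletSolution_zero_time (hsub hi), dirichletSolution_zero_time hi, sub_self]
      positivity
    · have := (neg_le_abs _).trans (hout t i hi)
      linarith

/-- The Dirichlet solutions converge to a bounded solution. -/
theorem exists_backwardSolution (hr : InwardRates α β) {u₀ : ℤ → ℝ} (hu₀ : IsBounded u₀) :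
    ∃ u, IsBackwardSolution α β u₀ u ∧
      ∀ t j, Tendsto (fun N => dirichletSolution α β N u₀ t j) atTop (𝓝 (u t j)) := by
  obtain ⟨C, hC0, hC⟩ := hr.exists_drift_bound
  obtain ⟨B, hB⟩ := hu₀
  have hlim : ∀ t j, ∃ x, Tendsto (fun N => dirichletSolution α β N u₀ t j) atTop (𝓝 x) := by
    intro t j
    refine cauchySeq_tendsto_of_complete ?_
    refine cauchySeq_of_le_tendsto_0' (fun N : ℕ => 2 * B / ((N : ℝ) + 1) * (|(j : ℝ)| + C * t))
      (fun N M hNM => ?_) ?_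
    · rw [dist_comm, Real.dist_eq]
      exact dirichletSolution_sub_le hr hC0 hC hB hNM t j
    · have := (tendsto_one_div_add_atTop_nhds_zero_nat (𝕜 := ℝ)).const_mul
        (2 * B * (|(j : ℝ)| + C * t))
      rw [mul_zero] at this
      refine this.congr fun N => ?_
      ring
  choose u hu using hlim
  refine ⟨u, IsBackwardSolution.of_tendsto hr (abs_dirichletSolution_le hr hB)
    (fun n => dirichletSolution_solvesOn α β n u₀) hu ?_, hu⟩
  ext j
  refine tendsto_nhds_unique (hu 0 j) ?_
  refine tendsto_const_nhds.congr' ?_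
  filter_upwards [eventually_ge_atTop j.natAbs] with n hn
  rw [dirichletSolution_zero_time]
  rw [Finset.mem_Icc]
  omega

theorem existsUnique_backwardSolution (hr : InwardRates α β) {u₀ : ℤ → ℝ} (hu₀ : IsBounded u₀) :
    ∃! u, IsBackwardSolution α β u₀ u := by
  obtain ⟨u, hu, -⟩ := exists_backwardSolution hr hu₀
  exact ⟨u, hu, fun v hv => hv.unique hr hu⟩


/-! ### Kernel representation and the transition function -/

/-- The sequence `δ_j`. -/
def pointMass (j i : ℤ) : ℝ := if i = j then 1 else 0

theorem isBounded_pointMass (j : ℤ) : IsBounded (pointMass j) :=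
  ⟨1, fun i => by unfold pointMass; split_ifs <;> simp⟩

/-- Bounded solutions are given by the kernel whose columns are the solutions which start at the
point masses. -/
theorem IsBackwardSolution.hasSum_kernel (hr : InwardRates α β) {p : ℝ≥0 → ℤ → ℤ → ℝ}
    (hp : ∀ j, IsBackwardSolution α β (pointMass j) (fun t i => p t i j)) {u₀ : ℤ → ℝ}
    {u : ℝ≥0 → ℤ → ℝ} (hu₀ : IsBounded u₀) (hu : IsBackwardSolution α β u₀ u) (t : ℝ≥0) (j : ℤ) :
    HasSum (fun i => p t j i * u₀ i) (u t j) := by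
  obtain ⟨C, hC0, hC⟩ := hr.exists_drift_bound
  obtain ⟨B, hB⟩ := hu₀
  have hB0 : 0 ≤ B := (abs_nonneg _).trans (hB 0)
  rw [HasSum, SummationFilter.unconditional_filter, Metric.tendsto_atTop]
  intro ε hε
  have hV : 0 ≤ |(j : ℝ)| + C * t := by positivity
  obtain ⟨N, hN⟩ := exists_nat_gt (B * (|(j : ℝ)| + C * t) / ε)
  refine ⟨Finset.Icc (-(N : ℤ)) N, fun F hF => ?_⟩
  -- The partial sum over `F` solves the equation with `u₀` cut off outside `F`. The initial error
  -- lives on `|k| ≥ N + 1`, hence lies below `B / (N + 1) * |k|`.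
  have hsum : IsBackwardSolution α β (fun k => ∑ i ∈ F, u₀ i * pointMass i k)
      (fun t k => ∑ i ∈ F, u₀ i * p t k i) :=
    IsBackwardSolution.sum F fun i => (hp i).mul (u₀ i)
  have hrem := hsum.sub hu
  have h0 : ∀ k, |(∑ i ∈ F, u₀ i * pointMass i k) - u₀ k| ≤ B / (N + 1) * |(k : ℝ)| := by
    intro k
    simp only [pointMass, mul_ite, mul_one, mul_zero, Finset.sum_ite_eq]
    split_ifs with hk
    · rw [sub_self, abs_zero]
      positivity
    · rw [zero_sub, abs_neg]
      refine (hB k).trans ?_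
      rw [div_mul_eq_mul_div, le_div_iff₀ (by positivity)]
      exact mul_le_mul_of_nonneg_left (abs_ge_of_notMem_Icc fun h => hk (hF h)) hB0
  have hc : 0 ≤ B / ((N : ℝ) + 1) := by positivity
  have h1 := hrem.le_barrier hr hC0 hC hc (fun k => (le_abs_self _).trans (h0 k)) t j
  have h2 := (hrem.mul (-1)).le_barrier hr hC0 hC hc
    (fun k => by
      have := (neg_le_abs _).trans (h0 k)
      linarith) t j
  have h3 : B / ((N : ℝ) + 1) * (|(j : ℝ)| + C * t) < ε := by
    rw [div_mul_eq_mul_div, div_lt_iff₀ (by positivity)]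
    rw [div_lt_iff₀ hε] at hN
    linarith
  rw [Real.dist_eq, abs_lt]
  have e : ∑ i ∈ F, p t j i * u₀ i = ∑ i ∈ F, u₀ i * p t j i :=
    Finset.sum_congr rfl fun i _ => mul_comm _ _
  rw [e]
  constructor <;> linarith

theorem IsBackwardSolution.isBounded {u₀ : ℤ → ℝ} {u : ℝ≥0 → ℤ → ℝ}
    (hu : IsBackwardSolution α β u₀ u) (t : ℝ≥0) : IsBounded (u t) :=
  let ⟨B, hB⟩ := hu.bounded
  ⟨B, hB t⟩

theorem backwardOp_pointMass (i j : ℤ) : backwardOp α β (pointMass j) i = rateMatrix α β i j := by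
  unfold backwardOp rateMatrix pointMass
  by_cases h1 : j = i + 1
  · rw [if_pos h1, if_neg (by omega), if_neg (by omega), if_pos (by omega)]
    ring
  · by_cases h2 : j = i - 1
    · rw [if_neg h1, if_pos h2, if_pos (by omega), if_neg (by omega), if_neg (by omega)]
      ring
    · rw [if_neg h1, if_neg h2, if_neg (by omega), if_neg (show ¬ i + 1 = j by omega)]
      by_cases h3 : j = i
      · rw [if_pos h3, if_pos h3.symm]
        ring
      · rw [if_neg h3, if_neg (Ne.symm h3)]
        ring

/-- Row sums come from representing the constant solution `1`; Chapman–Kolmogorov comes from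
representing the solution restarted at time `t`. -/
theorem isTransitionFunction_of_backward (hr : InwardRates α β) {p : ℝ≥0 → ℤ → ℤ → ℝ}
    (hp : ∀ j, IsBackwardSolution α β (pointMass j) (fun t i => p t i j)) :
    IsTransitionFunction α β p where
  nonneg t i j := (IsBackwardSolution.const 0).mono hr (hp j)
    (fun k => by unfold pointMass; split_ifs <;> simp) t i
  hasSum_one t i := by
    simpa using IsBackwardSolution.hasSum_kernel hr hp ⟨1, fun _ => by simp⟩
      (IsBackwardSolution.const 1) t i
  initial i j := congrFun (hp j).initial i
  chapman_kolmogorov s t i j :=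
    IsBackwardSolution.hasSum_kernel hr hp ((hp j).isBounded t) ((hp j).shift t) s i
  rates i j := by
    have := (hp j).equation 0 i
    rwa [(hp j).initial, backwardOp_pointMass] at this

theorem IsTransitionFunction.le_one {p : ℝ≥0 → ℤ → ℤ → ℝ} (hp : IsTransitionFunction α β p)
    (t : ℝ≥0) (i j : ℤ) : p t i j ≤ 1 :=
  le_hasSum (hp.hasSum_one t i) j fun k _ => hp.nonneg t i k

theorem IsTransitionFunction.exists_abs_rate_le {p : ℝ≥0 → ℤ → ℤ → ℝ}
    (hp : IsTransitionFunction α β p) (i k : ℤ) {ε : ℝ} (hε : 0 < ε) :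
    ∃ δ > 0, ∀ r : ℝ≥0, (r : ℝ) < δ →
      |p r i k - (if i = k then 1 else 0) - r * rateMatrix α β i k| ≤ ε * r := by
  have h := hp.rates i k
  rw [hasDerivWithinAt_iff_isLittleO, Asymptotics.isLittleO_iff] at h
  have h1 := h hε
  rw [eventually_nhdsWithin_iff, Metric.eventually_nhds_iff] at h1
  obtain ⟨δ, hδ, h2⟩ := h1
  refine ⟨δ, hδ, fun r hrδ => ?_⟩
  have h3 := @h2 (r : ℝ) (by simpa [abs_of_nonneg r.coe_nonneg] using hrδ) r.coe_nonneg
  simpa [hp.initial, abs_of_nonneg r.coe_nonneg] using h3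

/-- Chapman–Kolmogorov is split over the first short time `r`. Only jumps to `i - 1`, `i`, `i + 1`
need control: the rates in a row sum to zero, so the mass elsewhere is `o(r)`. The upper bound uses
three errors for the kept terms and three for the missing mass, hence `ε / 6`. -/
theorem IsTransitionFunction.exists_abs_increment_sub_le
    {p : ℝ≥0 → ℤ → ℤ → ℝ} (hp : IsTransitionFunction α β p) (i j : ℤ) {ε : ℝ} (hε : 0 < ε) :
    ∃ δ > 0, ∀ s r : ℝ≥0, (r : ℝ) < δ →
      |p (s + r) i j - p s i j - r * backwardOp α β (fun k => p s k j) i| ≤ ε * r := by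
  obtain ⟨δ₁, hδ₁, h1⟩ := hp.exists_abs_rate_le i (i - 1) (show 0 < ε / 6 by positivity)
  obtain ⟨δ₂, hδ₂, h2⟩ := hp.exists_abs_rate_le i i (show 0 < ε / 6 by positivity)
  obtain ⟨δ₃, hδ₃, h3⟩ := hp.exists_abs_rate_le i (i + 1) (show 0 < ε / 6 by positivity)
  refine ⟨min δ₁ (min δ₂ δ₃), by positivity, fun s r hrδ => ?_⟩
  rw [lt_min_iff, lt_min_iff] at hrδ
  have e1 := h1 r hrδ.1
  have e2 := h2 r hrδ.2.1
  have e3 := h3 r hrδ.2.2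
  have q1 : rateMatrix α β i (i - 1) = β i := by
    unfold rateMatrix
    rw [if_neg (by omega), if_pos rfl]
  have q2 : rateMatrix α β i i = -(α i + β i) := by
    unfold rateMatrix
    rw [if_neg (by omega), if_neg (by omega), if_pos rfl]
  have q3 : rateMatrix α β i (i + 1) = α i := by
    unfold rateMatrix
    rw [if_pos rfl]
  rw [q1, if_neg (by omega)] at e1
  rw [q2, if_pos rfl] at e2
  rw [q3, if_neg (by omega)] at e3
  have hsum : ∀ f : ℤ → ℝ, ∑ k ∈ {i - 1, i, i + 1}, f k = f (i - 1) + f i + f (i + 1) := by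
    intro f
    rw [Finset.sum_insert (by simp; omega), Finset.sum_insert (by simp), Finset.sum_singleton]
    ring
  have hck := hp.chapman_kolmogorov r s i j
  rw [add_comm r s] at hck
  have hn := hp.nonneg
  have hl := hp.le_one
  have b1 := sum_le_hasSum {i - 1, i, i + 1} (fun k _ => mul_nonneg (hn r i k) (hn s k j)) hck
  have b2 := sum_le_hasSum {i - 1, i, i + 1}
    (fun k _ => sub_nonneg.mpr (mul_le_of_le_one_right (hn r i k) (hl s k j)))
    ((hp.hasSum_one r i).sub hck)
  rw [hsum] at b1 b2
  have c : ∀ e k, |e| ≤ ε / 6 * r → |e * p s k j| ≤ ε / 6 * r := fun e k he => by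
    rw [abs_mul, abs_of_nonneg (hn s k j)]
    exact (mul_le_of_le_one_right (abs_nonneg _) (hl s k j)).trans he
  have d1 := abs_le.mp (c _ (i - 1) e1)
  have d2 := abs_le.mp (c _ i e2)
  have d3 := abs_le.mp (c _ (i + 1) e3)
  rw [abs_le] at e1 e2 e3 ⊢
  unfold backwardOp
  constructor <;> linarith

/-- This derives the backward equation at all times from the rates at time zero, and thereby
transfers uniqueness from bounded solutions to transition functions. -/
theorem IsTransitionFunction.backward (hr : InwardRates α β) {p : ℝ≥0 → ℤ → ℤ → ℝ}
    (hp : IsTransitionFunction α β p) (j : ℤ) :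
    IsBackwardSolution α β (pointMass j) (fun t i => p t i j) where
  initial := funext fun i => hp.initial i j
  bounded := ⟨1, fun t i => by
    rw [abs_of_nonneg (hp.nonneg t i j)]
    exact hp.le_one t i j⟩
  equation t i := by
    have hcont : ∀ k, ∀ η > 0, ∃ δ > 0, ∀ s r : ℝ≥0, (r : ℝ) < δ →
        |p (s + r) k j - p s k j| ≤ η := by
      intro k η hη
      obtain ⟨δ, hδ, h⟩ := hp.exists_abs_increment_sub_le k j one_pos
      have hα := hr.up_pos k
      have hβ := hr.down_pos k
      refine ⟨min δ (η / (1 + 2 * (α k + β k))), by positivity, fun s r hrδ => ?_⟩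
      rw [lt_min_iff, lt_div_iff₀ (by positivity)] at hrδ
      have h1 := h s r hrδ.1
      have hbd : ∀ k, |p s k j - 0| ≤ 1 := fun k => by
        rw [sub_zero, abs_of_nonneg (hp.nonneg s k j)]
        exact hp.le_one s k j
      have h2 := abs_backwardOp_sub_le hr (hbd (k - 1)) (hbd k) (hbd (k + 1))
        (u := fun k => p s k j) (v := fun _ => 0)
      rw [backwardOp_const, sub_zero] at h2
      have h3 : |(r : ℝ) * backwardOp α β (fun k => p s k j) k| ≤ r * (2 * (α k + β k)) := by
        rw [abs_mul, abs_of_nonneg r.coe_nonneg]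
        exact mul_le_mul_of_nonneg_left (by linarith) r.coe_nonneg
      rw [abs_le] at h1 h3 ⊢
      constructor <;> linarith
    refine hasDerivWithinAt_of_uniform_increments (f := fun t => p t i j)
      (f' := fun t => backwardOp α β (fun k => p t k j) i) (fun ε hε => ?_)
      (fun ε hε => hp.exists_abs_increment_sub_le i j hε) t
    have hα := hr.up_pos i
    have hβ := hr.down_pos i
    set η := ε / (2 * (α i + β i)) with hη
    have hη0 : 0 < η := by positivity
    obtain ⟨δ₁, hδ₁, h1⟩ := hcont (i - 1) η hη0
    obtain ⟨δ₂, hδ₂, h2⟩ := hcont i η hη0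
    obtain ⟨δ₃, hδ₃, h3⟩ := hcont (i + 1) η hη0
    refine ⟨min δ₁ (min δ₂ δ₃), by positivity, fun s r hrδ => ?_⟩
    rw [lt_min_iff, lt_min_iff] at hrδ
    refine (abs_backwardOp_sub_le hr (u := fun k => p (s + r) k j) (v := fun k => p s k j)
      (h1 s r hrδ.1) (h2 s r hrδ.2.1) (h3 s r hrδ.2.2)).trans ?_
    have : η * (2 * (α i + β i)) = ε := div_mul_cancel₀ _ (by positivity)
    linarith

/-- The transition function as the limit of the exponentials of the truncated rate matrices. -/
theorem exists_transitionFunction (hr : InwardRates α β) :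
    ∃ p, IsTransitionFunction α β p ∧ ∀ t i j,
      Tendsto (fun N => dirichletSolution α β N (pointMass j) t i) atTop (𝓝 (p t i j)) := by
  choose q hq hlim using fun j => exists_backwardSolution hr (isBounded_pointMass j)
  exact ⟨fun t i j => q j t i, isTransitionFunction_of_backward hr hq, fun t i j => hlim j t i⟩

theorem IsTransitionFunction.unique (hr : InwardRates α β) {p q : ℝ≥0 → ℤ → ℤ → ℝ}
    (hp : IsTransitionFunction α β p) (hq : IsTransitionFunction α β q) : p = q :=
  funext fun t => funext₂ fun i j =>
    congrFun (congrFun ((hp.backward hr j).unique hr (hq.backward hr j)) t) i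

theorem existsUnique_transitionFunction (hr : InwardRates α β) :
    ∃! p, IsTransitionFunction α β p := by
  obtain ⟨p, hp, -⟩ := exists_transitionFunction hr
  exact ⟨p, hp, fun q hq => hq.unique hr hp⟩


/-! ### Stationary distribution and reversibility -/

def DetailedBalance (α β : ℤ → ℝ) (w : ℤ → ℝ) : Prop :=
  ∀ j, α j * w j = β (j + 1) * w (j + 1)

theorem forall_of_iff_succ {P : ℤ → Prop} (h : ∀ j, P j ↔ P (j + 1)) {i : ℤ} (hi : P i) (j : ℤ) :
    P j := by
  have h0 : ∀ j, P j ↔ P 0 := by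
    intro j
    induction j using Int.induction_on with
    | zero => rfl
    | succ n ih => rw [← h, ih]
    | pred n ih =>
      have := h (-(n : ℤ) - 1)
      rw [sub_add_cancel] at this
      rw [this, ih]
  exact (h0 j).mpr ((h0 i).mp hi)

theorem DetailedBalance.forwardOp_eq_zero {w : ℤ → ℝ} (hw : DetailedBalance α β w) (j : ℤ) :
    forwardOp α β w j = 0 := by
  have h1 := hw (j - 1)
  have h2 := hw j
  rw [sub_add_cancel] at h1
  unfold forwardOp
  linarith

/-- Ratio test on each half-line: moving outward, the ratio of weights is an outward rate over an
inward rate. It is at most `1 / 2` once the inward rate exceeds `2 * A`. -/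
theorem DetailedBalance.summable (hr : InwardRates α β) {w : ℤ → ℝ} (hw : DetailedBalance α β w)
    (hpos : ∀ j, 0 < w j) : Summable w := by
  obtain ⟨A, hA, hB⟩ := hr.outward_bounded
  have hnat : Tendsto (fun n : ℕ => (n : ℤ)) atTop atTop := tendsto_natCast_atTop_atTop
  refine Summable.of_nat_of_neg ?_ ?_
  · refine summable_of_ratio_norm_eventually_le (r := 1 / 2) (by norm_num) ?_
    have h := (hr.down_tendsto.comp (tendsto_atTop_add_const_right _ 1 hnat)).eventually_ge_atTop
      (2 * A)
    filter_upwards [h] with n hn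
    simp only [Function.comp_apply] at hn
    rw [Real.norm_of_nonneg (hpos _).le, Real.norm_of_nonneg (hpos _).le]
    have e := hw n
    have hA0 : 0 < A := (hr.up_pos n).trans_le (hA n (by omega))
    have h1 := mul_le_mul_of_nonneg_right (hA n (by omega)) (hpos n).le
    have h2 := mul_le_mul_of_nonneg_right hn (hpos (n + 1)).le
    push_cast
    have h3 : A * w (n + 1) ≤ A * (1 / 2 * w n) := by linarith
    exact le_of_mul_le_mul_left h3 hA0
  · refine summable_of_ratio_norm_eventually_le (r := 1 / 2) (by norm_num) ?_
    have h := (hr.up_tendsto.comp (tendsto_neg_atTop_atBot.comp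
      (tendsto_atTop_add_const_right _ 1 hnat))).eventually_ge_atTop (2 * A)
    filter_upwards [h] with n hn
    simp only [Function.comp_apply] at hn
    rw [Real.norm_of_nonneg (hpos _).le, Real.norm_of_nonneg (hpos _).le]
    have e := hw (-((n : ℤ) + 1))
    rw [show -((n : ℤ) + 1) + 1 = -(n : ℤ) by ring] at e
    have hA0 : 0 < A := (hr.down_pos (-n)).trans_le (hB (-n) (by omega))
    have h1 := mul_le_mul_of_nonneg_right (hB (-n) (by omega)) (hpos (-n)).le
    have h2 := mul_le_mul_of_nonneg_right hn (hpos (-((n : ℤ) + 1))).le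
    push_cast
    have h3 : A * w (-((n : ℤ) + 1)) ≤ A * (1 / 2 * w (-n)) := by linarith
    exact le_of_mul_le_mul_left h3 hA0

theorem exists_detailedBalance (hr : InwardRates α β) :
    ∃ w, DetailedBalance α β w ∧ ∀ j, 0 < w j := by
  have hα := hr.up_pos
  have hβ := hr.down_pos
  -- Since `Int.toNat` truncates at zero, one of the two products is always empty, and the weight at
  -- `0` is `1`.
  refine ⟨fun j => (∏ k ∈ Finset.range j.toNat, α k / β (k + 1)) *
    ∏ k ∈ Finset.range (-j).toNat, β (-k) / α (-(k + 1)), fun j => ?_, fun j => ?_⟩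
  · beta_reduce
    rcases le_or_gt 0 j with h | h
    · rw [show (j + 1).toNat = j.toNat + 1 by omega, show (-j).toNat = 0 by omega,
        show (-(j + 1)).toNat = 0 by omega, Finset.prod_range_succ, Int.toNat_of_nonneg h]
      have := hβ (j + 1)
      field_simp
    · rw [show (-j).toNat = (-(j + 1)).toNat + 1 by omega, show j.toNat = 0 by omega,
        show (j + 1).toNat = 0 by omega, Finset.prod_range_succ,
        Int.toNat_of_nonneg (show 0 ≤ -(j + 1) by omega), neg_neg,
        show -(-(j + 1) + 1) = j by ring]
      have := hα j
      field_simp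
  · exact mul_pos (Finset.prod_pos fun k _ => div_pos (hα _) (hβ _))
      (Finset.prod_pos fun k _ => div_pos (hβ _) (hα _))

/-- Stationarity makes the flux `F` across edges constant. Far to the right `F ≤ A * w n`, far to
the left `-F ≤ A * w (-n)`, and both bounds tend to zero because `w` is summable. -/
theorem IsStationaryDistribution.detailedBalance (hr : InwardRates α β) {w : ℤ → ℝ}
    (hw : IsStationaryDistribution α β w) : DetailedBalance α β w := by
  obtain ⟨A, hA, hB⟩ := hr.outward_bounded
  have hflux : ∀ j, α j * w j - β (j + 1) * w (j + 1) = α 0 * w 0 - β (0 + 1) * w (0 + 1) := by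
    intro j
    refine forall_of_iff_succ (P := fun j => α j * w j - β (j + 1) * w (j + 1) =
      α 0 * w 0 - β (0 + 1) * w (0 + 1)) (fun j => ?_) rfl j
    have h := hw.stationary (j + 1)
    unfold forwardOp at h
    rw [add_sub_cancel_right] at h
    have e : α j * w j - β (j + 1) * w (j + 1) =
      α (j + 1) * w (j + 1) - β (j + 1 + 1) * w (j + 1 + 1) := by linarith
    rw [e]
  set F := α 0 * w 0 - β (0 + 1) * w (0 + 1) with hF
  have hs := hw.hasSum_one.summable
  have l1 : Tendsto (fun n : ℕ => A * w n) atTop (𝓝 (A * 0)) :=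
    ((hs.comp_injective (i := fun n : ℕ => (n : ℤ))
      Nat.cast_injective).tendsto_atTop_zero).const_mul A
  have l2 : Tendsto (fun n : ℕ => A * w (-n)) atTop (𝓝 (A * 0)) :=
    ((hs.comp_injective (i := fun n : ℕ => -(n : ℤ))
      (neg_injective.comp Nat.cast_injective)).tendsto_atTop_zero).const_mul A
  have h1 : F ≤ A * 0 := ge_of_tendsto' l1 fun n => by
    have h := hflux n
    have h2 := mul_le_mul_of_nonneg_right (hA n (by omega)) (hw.nonneg n)
    have h3 := mul_nonneg (hr.down_pos (n + 1)).le (hw.nonneg (n + 1))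
    linarith
  have h2 : -F ≤ A * 0 := ge_of_tendsto' l2 fun n => by
    have h := hflux (-n - 1)
    rw [sub_add_cancel] at h
    have h2 := mul_le_mul_of_nonneg_right (hB (-n) (by omega)) (hw.nonneg (-n))
    have h3 := mul_nonneg (hr.up_pos (-n - 1)).le (hw.nonneg (-n - 1))
    linarith
  intro j
  have := hflux j
  linarith

theorem IsStationaryDistribution.pos (hr : InwardRates α β) {w : ℤ → ℝ}
    (hw : IsStationaryDistribution α β w) (j : ℤ) : 0 < w j := by
  have hdb := hw.detailedBalance hr
  obtain ⟨i, hi⟩ : ∃ i, 0 < w i := by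
    by_contra! h
    have h0 : w = fun _ => 0 := funext fun i => le_antisymm (h i) (hw.nonneg i)
    have h1 := hw.hasSum_one
    rw [h0] at h1
    exact zero_ne_one (hasSum_zero.unique h1)
  refine forall_of_iff_succ (P := fun j => 0 < w j) (fun j => ?_) hi j
  rw [← mul_pos_iff_of_pos_left (hr.up_pos j), hdb j, mul_pos_iff_of_pos_left (hr.down_pos (j + 1))]

theorem existsUnique_stationaryDistribution (hr : InwardRates α β) :
    ∃! w, IsStationaryDistribution α β w := by
  obtain ⟨m, hm, hpos⟩ := exists_detailedBalance hr
  have hsum := hm.summable hr hpos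
  have hZ : 0 < ∑' j, m j := hsum.tsum_pos (fun j => (hpos j).le) 0 (hpos 0)
  have hdb : DetailedBalance α β fun j => m j / ∑' j, m j := fun j => by
    rw [← mul_div_assoc, hm j, mul_div_assoc]
  have hex : IsStationaryDistribution α β fun j => m j / ∑' j, m j :=
    { nonneg := fun j => div_nonneg (hpos j).le hZ.le
      hasSum_one := by
        have := hsum.hasSum.div_const (∑' j, m j)
        rwa [div_self hZ.ne'] at this
      stationary := hdb.forwardOp_eq_zero }
  refine ⟨_, hex, fun v hv => ?_⟩
  set w := fun j => m j / ∑' j, m j with hw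
  have hvdb := hv.detailedBalance hr
  -- Detailed balance fixes the ratios of neighbouring weights, so the two distributions are
  -- proportional; equal total mass then makes them equal.
  have hprop : ∀ j, v j * w 0 = w j * v 0 := by
    intro j
    refine forall_of_iff_succ (P := fun j => v j * w 0 = w j * v 0) (fun j => ?_)
      (mul_comm (v 0) (w 0)) j
    have h1 := hvdb j
    have h2 := hdb j
    have e1 : α j * (v j * w 0 - w j * v 0) =
        β (j + 1) * (v (j + 1) * w 0 - w (j + 1) * v 0) := by
      linear_combination w 0 * h1 - v 0 * h2
    have ha := (hr.up_pos j).ne'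
    have hb := (hr.down_pos (j + 1)).ne'
    rw [← sub_eq_zero, ← mul_eq_zero_iff_left ha, e1, mul_eq_zero_iff_left hb, sub_eq_zero]
  have h0 : w 0 = v 0 := by
    have h1 := hv.hasSum_one.mul_right (w 0)
    have h2 := hex.hasSum_one.mul_right (v 0)
    simp only [hprop, one_mul] at h1 h2
    exact h1.unique h2
  funext j
  have := hprop j
  rw [← h0] at this
  exact mul_right_cancel₀ (hex.pos hr 0).ne' this

theorem rateMatrix_reversible {w : ℤ → ℝ} (hw : DetailedBalance α β w) (i j : ℤ) :
    w i * rateMatrix α β i j = w j * rateMatrix α β j i := by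
  unfold rateMatrix
  by_cases h1 : j = i + 1
  · have := hw i
    subst h1
    rw [if_pos rfl, if_neg (by omega), if_pos (by omega)]
    linarith
  · by_cases h2 : j = i - 1
    · have := hw j
      obtain rfl : i = j + 1 := by omega
      rw [if_neg h1, if_pos h2, if_pos rfl]
      linarith
    · rw [if_neg h1, if_neg h2, if_neg (show ¬ i = j + 1 by omega),
        if_neg (show ¬ i = j - 1 by omega)]
      by_cases h3 : j = i
      · rw [h3]
      · rw [if_neg h3, if_neg (Ne.symm h3), mul_zero, mul_zero]

/-- With `D` the diagonal matrix of weights, reversibility reads `Aᵀ = D A D⁻¹`, and the exponential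
commutes with transposition and conjugation. -/
theorem exp_reversible {n : Type*} [Fintype n] [DecidableEq n] {A : Matrix n n ℝ} {w : n → ℝ}
    (hw : ∀ i, w i ≠ 0) (hA : ∀ i j, w i * A i j = w j * A j i) (i j : n) :
    w i * NormedSpace.exp A i j = w j * NormedSpace.exp A j i := by
  have hD : IsUnit (Matrix.diagonal w) := by
    rw [Matrix.isUnit_diagonal, Pi.isUnit_iff]
    exact fun i => (hw i).isUnit
  have hdet : IsUnit (Matrix.diagonal w).det := (Matrix.isUnit_iff_isUnit_det _).mp hD
  have h1 : Matrix.diagonal w * A = A.transpose * Matrix.diagonal w := by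
    ext i j
    rw [Matrix.diagonal_mul, Matrix.mul_diagonal, Matrix.transpose_apply, hA, mul_comm]
  have h2 : A.transpose = Matrix.diagonal w * A * (Matrix.diagonal w)⁻¹ := by
    rw [h1, Matrix.mul_nonsing_inv_cancel_right _ _ hdet]
  have h3 := Matrix.exp_conj (Matrix.diagonal w) A hD
  rw [← h2, Matrix.exp_transpose] at h3
  have h4 : (NormedSpace.exp A).transpose * Matrix.diagonal w =
      Matrix.diagonal w * NormedSpace.exp A := by
    rw [h3, Matrix.nonsing_inv_mul_cancel_right _ _ hdet]
  have h5 := congrFun (congrFun h4 i) j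
  rw [Matrix.diagonal_mul, Matrix.mul_diagonal, Matrix.transpose_apply] at h5
  rw [← h5, mul_comm]

theorem IsTransitionFunction.reversible (hr : InwardRates α β) {p : ℝ≥0 → ℤ → ℤ → ℝ}
    (hp : IsTransitionFunction α β p) {w : ℤ → ℝ} (hw : DetailedBalance α β w)
    (hpos : ∀ j, 0 < w j) (t : ℝ≥0) (i j : ℤ) : w i * p t i j = w j * p t j i := by
  obtain ⟨q, hq, hlim⟩ := exists_transitionFunction hr
  obtain rfl := hp.unique hr hq
  -- The truncated kernels are matrix exponentials, to which `exp_reversible` applies before passing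
  -- to the limit.
  have hentry : ∀ (N : ℕ) {k l : ℤ} (hk : k ∈ Finset.Icc (-(N : ℤ)) N)
      (hl : l ∈ Finset.Icc (-(N : ℤ)) N), dirichletSolution α β N (pointMass l) t k =
        NormedSpace.exp ((t : ℝ) • dirichletMatrix α β N) ⟨k, hk⟩ ⟨l, hl⟩ := by
    intro N k l hk hl
    have e : (fun i : Finset.Icc (-(N : ℤ)) N => pointMass l i) = Pi.single ⟨l, hl⟩ 1 := by
      funext i
      simp [pointMass, Pi.single_apply, Subtype.ext_iff]
    rw [dirichletSolution, dif_pos hk, e, Matrix.mulVec_single_one]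
    rfl
  refine tendsto_nhds_unique ((hlim t i j).const_mul (w i)) ?_
  refine ((hlim t j i).const_mul (w j)).congr' ?_
  filter_upwards [eventually_ge_atTop (max i.natAbs j.natAbs)] with N hN
  have hi : i ∈ Finset.Icc (-(N : ℤ)) N := by rw [Finset.mem_Icc]; omega
  have hj : j ∈ Finset.Icc (-(N : ℤ)) N := by rw [Finset.mem_Icc]; omega
  rw [hentry N hi hj, hentry N hj hi]
  refine exp_reversible (w := fun k : Finset.Icc (-(N : ℤ)) N => w k) (fun k => (hpos k).ne')
    (fun k l => ?_) ⟨j, hj⟩ ⟨i, hi⟩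
  have := rateMatrix_reversible hw k l
  simp only [Matrix.smul_apply, dirichletMatrix, Matrix.of_apply, smul_eq_mul]
  linear_combination (t : ℝ) * this


/-! ### Total variation -/

/-- The partial sums `∑_{k ≤ j} d_k`. -/
noncomputable def cumulative (d : ℤ → ℝ) (j : ℤ) : ℝ := ∑' k, Set.indicator (Set.Iic j) d k

theorem cumulative_sub {d : ℤ → ℝ} (hd : Summable d) (j : ℤ) :
    cumulative d j - cumulative d (j - 1) = d j := by
  unfold cumulative
  rw [← (hd.indicator _).tsum_sub (hd.indicator _), tsum_eq_single j]
  · simp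
  · intro k hk
    have : k ≤ j ↔ k ≤ j - 1 := by omega
    simp [Set.indicator_apply, this]

theorem cumulative_mem {d : ℤ → ℝ} (hd : Summable d) (h0 : ∀ k, 0 ≤ d k) (j : ℤ) :
    0 ≤ cumulative d j ∧ cumulative d j ≤ ∑' k, d k :=
  ⟨tsum_nonneg fun k => Set.indicator_nonneg (fun k _ => h0 k) k,
    (hd.indicator _).tsum_le_tsum (fun k => Set.indicator_le_self' (fun k _ => h0 k) k) hd⟩

theorem cumulative_monotone {d : ℤ → ℝ} (hd : Summable d) (h0 : ∀ k, 0 ≤ d k) :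
    Monotone (cumulative d) := fun _ _ hij =>
  (hd.indicator _).tsum_le_tsum
    (Set.indicator_le_indicator_of_subset (Set.Iic_subset_Iic.mpr hij) h0) (hd.indicator _)

/-- Increments are nonnegative, so `F` may be enlarged to a symmetric interval, where the sum
telescopes. -/
theorem sum_increments_le {a : ℤ → ℝ} (ha : Monotone a) {P : ℝ} (h0 : ∀ j, 0 ≤ a j)
    (hP : ∀ j, a j ≤ P) (F : Finset ℤ) : ∑ j ∈ F, (a j - a (j - 1)) ≤ P := by
  obtain ⟨n, hn⟩ : ∃ n : ℕ, F ⊆ Finset.Ico (-(n : ℤ)) n := by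
    refine ⟨F.sup Int.natAbs + 1, fun j hj => ?_⟩
    have := Finset.le_sup (f := Int.natAbs) hj
    rw [Finset.mem_Ico]
    omega
  have htel : ∀ n : ℕ, ∑ j ∈ Finset.Ico (-(n : ℤ)) n, (a j - a (j - 1)) =
      a (n - 1) - a (-n - 1) := by
    intro n
    induction n with
    | zero => simp
    | succ n ih =>
      have e : Finset.Ico (-((n + 1 : ℕ) : ℤ)) ((n + 1 : ℕ) : ℤ) =
          insert (-(n : ℤ) - 1) (insert (n : ℤ) (Finset.Ico (-(n : ℤ)) n)) := by
        ext j
        simp only [Finset.mem_Ico, Finset.mem_insert]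
        omega
      rw [e, Finset.sum_insert, Finset.sum_insert, ih]
      · push_cast
        rw [add_sub_cancel_right, neg_add, ← sub_eq_add_neg]
        ring
      · simp
      · simp only [Finset.mem_Ico, Finset.mem_insert]
        omega
  calc ∑ j ∈ F, (a j - a (j - 1)) ≤ ∑ j ∈ Finset.Ico (-(n : ℤ)) n, (a j - a (j - 1)) :=
        Finset.sum_le_sum_of_subset_of_nonneg hn fun j _ _ =>
          sub_nonneg.mpr (ha (sub_one_lt j).le)
    _ = a (n - 1) - a (-n - 1) := htel n
    _ ≤ P := by linarith [h0 (-n - 1), hP (n - 1)]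

/-- The total variation of a solution is at most its initial total variation. -/
theorem IsBackwardSolution.sum_abs_increments_le (hr : InwardRates α β) {v : ℤ → ℝ}
    {u : ℝ≥0 → ℤ → ℝ} (hu : IsBackwardSolution α β v u)
    (hv : Summable fun j => |v j - v (j - 1)|) (t : ℝ≥0) (F : Finset ℤ) :
    ∑ j ∈ F, |u t j - u t (j - 1)| ≤ ∑' j, |v j - v (j - 1)| := by
  set d : ℤ → ℝ := fun j => v j - v (j - 1) with hd
  have hsp : Summable fun j => max (d j) 0 :=
    hv.of_nonneg_of_le (fun j => le_max_right _ _) fun j => max_le (le_abs_self _) (abs_nonneg _)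
  have hsm : Summable fun j => max (-d j) 0 :=
    hv.of_nonneg_of_le (fun j => le_max_right _ _) fun j => max_le (neg_le_abs _) (abs_nonneg _)
  -- Jordan decomposition: `a` and `b` accumulate the positive and negative increments of `v`, so
  -- `v` is `a - b` up to a constant.
  set a := cumulative fun j => max (d j) 0 with ha
  set b := cumulative fun j => max (-d j) 0 with hb
  have hap : ∀ j, 0 ≤ max (d j) 0 := fun j => le_max_right _ _
  have hbp : ∀ j, 0 ≤ max (-d j) 0 := fun j => le_max_right _ _
  have hamem := cumulative_mem hsp hap
  have hbmem := cumulative_mem hsm hbp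
  obtain ⟨x, hx, -⟩ := exists_backwardSolution hr (u₀ := a)
    ⟨_, fun j => (abs_of_nonneg (hamem j).1).trans_le (hamem j).2⟩
  obtain ⟨y, hy, -⟩ := exists_backwardSolution hr (u₀ := b)
    ⟨_, fun j => (abs_of_nonneg (hbmem j).1).trans_le (hbmem j).2⟩
  have hdecomp : v = fun j => (a j - b j) + (v 0 - (a 0 - b 0)) := by
    funext j
    refine forall_of_iff_succ (P := fun j => v j = (a j - b j) + (v 0 - (a 0 - b 0)))
      (fun j => ?_) (i := 0) (by ring) j
    have h1 := cumulative_sub hsp (j + 1)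
    have h2 := cumulative_sub hsm (j + 1)
    rw [← ha, add_sub_cancel_right] at h1
    rw [← hb, add_sub_cancel_right] at h2
    have h3 : d (j + 1) = v (j + 1) - v j := by simp [hd]
    have h4 : max (d (j + 1)) 0 - max (-d (j + 1)) 0 = d (j + 1) := by
      rcases le_total (d (j + 1)) 0 with h | h
      · rw [max_eq_right h, max_eq_left (by linarith)]; ring
      · rw [max_eq_left h, max_eq_right (by linarith)]; ring
    constructor <;> intro h <;> linarith
  have hsol := (hx.sub hy).add (IsBackwardSolution.const (α := α) (β := β) (v 0 - (a 0 - b 0)))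
  rw [← hdecomp] at hsol
  obtain rfl := hu.unique hr hsol
  have hxm := hx.monotone hr (cumulative_monotone hsp hap) t
  have hym := hy.monotone hr (cumulative_monotone hsm hbp) t
  -- The evolved `a` is still monotone and, by comparison with constants, stays between `0` and its
  -- initial total increase; likewise for `b`.
  have hx1 := sum_increments_le hxm
    (fun j => (IsBackwardSolution.const 0).mono hr hx (fun j => (hamem j).1) t j)
    (fun j => hx.mono hr (IsBackwardSolution.const _) (fun j => (hamem j).2) t j) F
  have hy1 := sum_increments_le hym
    (fun j => (IsBackwardSolution.const 0).mono hr hy (fun j => (hbmem j).1) t j)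
    (fun j => hy.mono hr (IsBackwardSolution.const _) (fun j => (hbmem j).2) t j) F
  have hTV : ∑' j, |d j| = ∑' j, max (d j) 0 + ∑' j, max (-d j) 0 := by
    rw [← hsp.tsum_add hsm]
    refine tsum_congr fun j => ?_
    rcases le_total (d j) 0 with h | h
    · rw [max_eq_right h, max_eq_left (by linarith), abs_of_nonpos h, zero_add]
    · rw [max_eq_left h, max_eq_right (by linarith), abs_of_nonneg h, add_zero]
  rw [hTV]
  refine le_trans ?_ (add_le_add hx1 hy1)
  rw [← Finset.sum_add_distrib]
  refine Finset.sum_le_sum fun j _ => ?_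
  have h1 := hxm (sub_one_lt j).le
  have h2 := hym (sub_one_lt j).le
  rw [abs_le]
  constructor <;> linarith

/-- The bound by the initial variation, applied to the solution restarted at time `s`, yields
monotonicity in time. -/
theorem IsBackwardSolution.totalVariation_diminishing (hr : InwardRates α β) {v : ℤ → ℝ}
    {u : ℝ≥0 → ℤ → ℝ} (hu : IsBackwardSolution α β v u) (hv : Summable fun j => |v j|) :
    (∀ t, Summable fun j : ℤ => |u t j - u t (j - 1)|) ∧
      Antitone fun t : ℝ≥0 => ∑' j : ℤ, |u t j - u t (j - 1)| := by
  have hv1 : Summable fun j => |v j - v (j - 1)| :=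
    (hv.add ((Equiv.subRight (1 : ℤ)).summable_iff.mpr hv)).of_nonneg_of_le
      (fun j => abs_nonneg _) fun j => abs_sub _ _
  have hs : ∀ t, Summable fun j : ℤ => |u t j - u t (j - 1)| := fun t =>
    summable_of_sum_le (fun j => abs_nonneg _) (hu.sum_abs_increments_le hr hv1 t)
  refine ⟨hs, fun s t hst => ?_⟩
  obtain ⟨r, rfl⟩ := exists_add_of_le hst
  have := (hu.shift s).sum_abs_increments_le hr (hs s) r
  simp only [add_comm r s] at this
  exact Real.tsum_le_of_sum_le (fun j => abs_nonneg _) this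


/-! ### Reversible kernels on weighted spaces -/

theorem lintegral_weightMeasure (w : ℤ → ℝ) (f : ℤ → ℝ≥0∞) :
    ∫⁻ x, f x ∂weightMeasure w = ∑' j, ENNReal.ofReal (w j) * f j := by
  simp [weightMeasure, lintegral_sum_measure, lintegral_smul_measure]

theorem hasSum_integral_weightMeasure {w : ℤ → ℝ} (hw : ∀ j, 0 ≤ w j) {f : ℤ → ℝ}
    (hf : Integrable f (weightMeasure w)) :
    HasSum (fun j => w j * f j) (∫ x, f x ∂weightMeasure w) := by
  have := hasSum_integral_measure hf
  simp only [integral_smul_measure, integral_dirac, ENNReal.toReal_ofReal (hw _),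
    smul_eq_mul] at this
  exact this

/-- Every point has positive mass, so the only null set is empty and elements of `Lp` are genuine
functions. -/
theorem ae_weightMeasure_iff {w : ℤ → ℝ} (hw : ∀ j, 0 < w j) {P : ℤ → Prop} :
    (∀ᵐ x ∂weightMeasure w, P x) ↔ ∀ x, P x := by
  rw [ae_iff_of_countable]
  refine forall_congr' fun x => ?_
  have : weightMeasure w {x} ≠ 0 := by
    rw [← lintegral_indicator_one (MeasurableSet.singleton x), lintegral_weightMeasure]
    refine ne_of_gt (lt_of_lt_of_le ?_ (ENNReal.le_tsum x))
    simpa using hw x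
  simp [this]

theorem eq_of_ae_eq_weightMeasure {w : ℤ → ℝ} (hw : ∀ j, 0 < w j) {f g : ℤ → ℝ}
    (h : f =ᵐ[weightMeasure w] g) : f = g :=
  funext ((ae_weightMeasure_iff hw).mp h)

theorem isProbabilityMeasure_weightMeasure {w : ℤ → ℝ} (h0 : ∀ j, 0 ≤ w j) (h1 : HasSum w 1) :
    IsProbabilityMeasure (weightMeasure w) where
  measure_univ := by
    rw [← lintegral_one, lintegral_weightMeasure]
    simp only [mul_one]
    rw [← ENNReal.ofReal_tsum_of_nonneg h0 h1.summable, h1.tsum_eq, ENNReal.ofReal_one]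

/-- A Markov kernel `κ` on `ℤ` which is reversible for the positive probability weights `w`. -/
structure ReversibleKernel (w : ℤ → ℝ) (κ : ℤ → ℤ → ℝ) : Prop where
  weight_pos : ∀ j, 0 < w j
  weight_sum : HasSum w 1
  nonneg : ∀ i j, 0 ≤ κ i j
  hasSum_one : ∀ i, HasSum (κ i) 1
  reversible : ∀ i j, w i * κ i j = w j * κ j i

/-- The action of the kernel `κ` on functions. -/
noncomputable def average (κ : ℤ → ℤ → ℝ) (f : ℤ → ℝ) (i : ℤ) : ℝ :=
  ∫ x, f x ∂weightMeasure (κ i)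

namespace ReversibleKernel

variable {w : ℤ → ℝ} {κ : ℤ → ℤ → ℝ}

theorem isProbabilityMeasure_weight (hκ : ReversibleKernel w κ) :
    IsProbabilityMeasure (weightMeasure w) :=
  isProbabilityMeasure_weightMeasure (fun j => (hκ.weight_pos j).le) hκ.weight_sum

theorem isProbabilityMeasure_kernel (hκ : ReversibleKernel w κ) (i : ℤ) :
    IsProbabilityMeasure (weightMeasure (κ i)) :=
  isProbabilityMeasure_weightMeasure (hκ.nonneg i) (hκ.hasSum_one i)

/-- Reversibility gives `w i * κ i j = w j * κ j i ≤ w j`, so each row of the kernel is dominated by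
`w / w i`. -/
theorem integrable_kernel (hκ : ReversibleKernel w κ) {p : ℝ≥0∞} (hp : 1 ≤ p) {f : ℤ → ℝ}
    (hf : MemLp f p (weightMeasure w)) (i : ℤ) : Integrable f (weightMeasure (κ i)) := by
  have := hκ.isProbabilityMeasure_weight
  have hint := (hf.integrable hp).2
  refine ⟨AEStronglyMeasurable.of_discrete, ?_⟩
  rw [HasFiniteIntegral, lintegral_weightMeasure] at hint ⊢
  refine lt_of_le_of_lt ?_ (ENNReal.mul_lt_top (ENNReal.ofReal_lt_top (r := (w i)⁻¹)) hint)
  rw [← ENNReal.tsum_mul_left]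
  refine ENNReal.tsum_le_tsum fun j => ?_
  rw [← mul_assoc, ← ENNReal.ofReal_mul (inv_nonneg.mpr (hκ.weight_pos i).le)]
  gcongr
  have hi := hκ.weight_pos i
  have hle : κ j i ≤ 1 := le_hasSum (hκ.hasSum_one j) i fun k _ => hκ.nonneg j k
  rw [← div_eq_inv_mul, le_div_iff₀ hi, mul_comm, hκ.reversible]
  exact mul_le_of_le_one_right (hκ.weight_pos j).le hle

theorem hasSum_average (hκ : ReversibleKernel w κ) {p : ℝ≥0∞} (hp : 1 ≤ p) {f : ℤ → ℝ}
    (hf : MemLp f p (weightMeasure w)) (i : ℤ) :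
    HasSum (fun j => κ i j * f j) (average κ f i) :=
  hasSum_integral_weightMeasure (hκ.nonneg i) (hκ.integrable_kernel hp hf i)

/-- Jensen's inequality. -/
theorem enorm_average_rpow_le (hκ : ReversibleKernel w κ) {r : ℝ} (hr : 1 ≤ r) (f : ℤ → ℝ)
    (i : ℤ) : ‖average κ f i‖ₑ ^ r ≤ ∑' j, ENNReal.ofReal (κ i j) * ‖f j‖ₑ ^ r := by
  have := hκ.isProbabilityMeasure_kernel i
  have hr0 : 0 < r := by linarith
  rw [← lintegral_weightMeasure, lintegral_rpow_enorm_eq_rpow_eLpNorm' hr0]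
  refine ENNReal.rpow_le_rpow ?_ hr0.le
  refine (enorm_integral_le_lintegral_enorm f).trans ?_
  refine le_trans (le_of_eq ?_) (eLpNorm'_le_eLpNorm'_of_exponent_le one_pos hr _
    AEStronglyMeasurable.of_discrete)
  simp [eLpNorm'_eq_lintegral_enorm]

/-- For finite `p`, Jensen's inequality is summed against `w`; by reversibility `∑ i, w i * κ i j =
w j`, so no mass is gained. For `p = ⊤`, averaging preserves a uniform bound. -/
theorem eLpNorm_average_le (hκ : ReversibleKernel w κ) {p : ℝ≥0∞} (hp : 1 ≤ p) (f : ℤ → ℝ) :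
    eLpNorm (average κ f) p (weightMeasure w) ≤ eLpNorm f p (weightMeasure w) := by
  have hp0 : p ≠ 0 := (zero_lt_one.trans_le hp).ne'
  by_cases htop : p = ⊤
  · subst htop
    rw [eLpNorm_exponent_top, eLpNorm_exponent_top]
    refine eLpNormEssSup_le_of_ae_enorm_bound (Eventually.of_forall fun i => ?_)
    have hae := (ae_weightMeasure_iff hκ.weight_pos).mp
      (ae_le_eLpNormEssSup (f := f) (μ := weightMeasure w))
    have := hκ.isProbabilityMeasure_kernel i
    refine (enorm_integral_le_lintegral_enorm f).trans ?_
    refine (lintegral_mono hae).trans ?_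
    simp
  · have hr : 1 ≤ p.toReal := by
      rw [← ENNReal.toReal_one]
      exact ENNReal.toReal_mono htop hp
    rw [eLpNorm_eq_lintegral_rpow_enorm_toReal hp0 htop,
      eLpNorm_eq_lintegral_rpow_enorm_toReal hp0 htop]
    refine ENNReal.rpow_le_rpow ?_ (by positivity)
    rw [lintegral_weightMeasure, lintegral_weightMeasure]
    calc ∑' i, ENNReal.ofReal (w i) * ‖average κ f i‖ₑ ^ p.toReal
        ≤ ∑' i, ENNReal.ofReal (w i) * ∑' j, ENNReal.ofReal (κ i j) * ‖f j‖ₑ ^ p.toReal := by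
          gcongr with i
          exact hκ.enorm_average_rpow_le hr f i
      _ = ∑' i, ∑' j, ENNReal.ofReal (w j) * ‖f j‖ₑ ^ p.toReal * ENNReal.ofReal (κ j i) := by
          refine tsum_congr fun i => ?_
          rw [← ENNReal.tsum_mul_left]
          refine tsum_congr fun j => ?_
          rw [← mul_assoc, ← ENNReal.ofReal_mul (hκ.weight_pos i).le, hκ.reversible,
            ENNReal.ofReal_mul (hκ.weight_pos j).le]
          ring
      _ = ∑' j, ENNReal.ofReal (w j) * ‖f j‖ₑ ^ p.toReal := by
          rw [ENNReal.tsum_comm]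
          refine tsum_congr fun j => ?_
          rw [ENNReal.tsum_mul_left, ← ENNReal.ofReal_tsum_of_nonneg (hκ.nonneg j)
            (hκ.hasSum_one j).summable, (hκ.hasSum_one j).tsum_eq, ENNReal.ofReal_one, mul_one]

theorem memLp_average (hκ : ReversibleKernel w κ) {p : ℝ≥0∞} (hp : 1 ≤ p) {f : ℤ → ℝ}
    (hf : MemLp f p (weightMeasure w)) : MemLp (average κ f) p (weightMeasure w) :=
  ⟨AEStronglyMeasurable.of_discrete, (hκ.eLpNorm_average_le hp f).trans_lt hf.2⟩

/-- The kernel as a bounded operator on `ℓ^p(w)`. -/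
noncomputable def averageL (hκ : ReversibleKernel w κ) (p : ℝ≥0∞) [hp : Fact (1 ≤ p)] :
    Lp ℝ p (weightMeasure w) →L[ℝ] Lp ℝ p (weightMeasure w) :=
  LinearMap.mkContinuous
    { toFun := fun f => (hκ.memLp_average hp.out (Lp.memLp f)).toLp _
      map_add' := fun f g => by
        have hf := hκ.memLp_average hp.out (Lp.memLp f)
        have hg := hκ.memLp_average hp.out (Lp.memLp g)
        rw [← MemLp.toLp_add hf hg, MemLp.toLp_eq_toLp_iff,
          eq_of_ae_eq_weightMeasure hκ.weight_pos (Lp.coeFn_add f g)]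
        refine Eventually.of_forall fun i => ?_
        exact integral_add (hκ.integrable_kernel hp.out (Lp.memLp f) i)
          (hκ.integrable_kernel hp.out (Lp.memLp g) i)
      map_smul' := fun c f => by
        have hf := hκ.memLp_average hp.out (Lp.memLp f)
        rw [RingHom.id_apply, ← MemLp.toLp_const_smul c hf, MemLp.toLp_eq_toLp_iff,
          eq_of_ae_eq_weightMeasure hκ.weight_pos (Lp.coeFn_smul c f)]
        refine Eventually.of_forall fun i => ?_
        exact integral_const_mul c _ }
    1 fun f => by
      rw [one_mul, Lp.norm_def f]
      refine (Lp.norm_toLp _ (hκ.memLp_average hp.out (Lp.memLp f))).trans_le ?_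
      exact ENNReal.toReal_mono (Lp.eLpNorm_ne_top f) (hκ.eLpNorm_average_le hp.out f)

theorem norm_averageL_le (hκ : ReversibleKernel w κ) (p : ℝ≥0∞) [Fact (1 ≤ p)] :
    ‖hκ.averageL p‖ ≤ 1 :=
  LinearMap.mkContinuous_norm_le _ zero_le_one _

theorem coeFn_averageL (hκ : ReversibleKernel w κ) (p : ℝ≥0∞) [hp : Fact (1 ≤ p)]
    (f : Lp ℝ p (weightMeasure w)) : ⇑(hκ.averageL p f) = average κ f :=
  eq_of_ae_eq_weightMeasure hκ.weight_pos
    (MemLp.coeFn_toLp (hκ.memLp_average hp.out (Lp.memLp f)))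

theorem summable_weight_mul_sq (hκ : ReversibleKernel w κ) (f : Lp ℝ 2 (weightMeasure w)) :
    Summable fun x : ℤ × ℤ => w x.1 * κ x.1 x.2 * f x.1 ^ 2 := by
  have h1 := hasSum_integral_weightMeasure (fun j => (hκ.weight_pos j).le) (Lp.memLp f).integrable_sq
  have hrow : ∀ i, HasSum (fun j => w i * κ i j * f i ^ 2) (w i * f i ^ 2) := fun i => by
    have := ((hκ.hasSum_one i).mul_left (w i)).mul_right (f i ^ 2)
    rwa [mul_one] at this
  rw [summable_prod_of_nonneg]
  · refine ⟨fun i => (hrow i).summable, ?_⟩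
    simp only [fun i => (hrow i).tsum_eq]
    exact h1.summable
  · intro x
    exact mul_nonneg (mul_nonneg (hκ.weight_pos _).le (hκ.nonneg _ _)) (sq_nonneg _)

/-- Both sides are the double sum of `w i * κ i j * f j * g i`, summed by rows or by columns;
reversibility identifies the columns. Absolute convergence follows from `|f j * g i| ≤ f j ^ 2 + g i
^ 2`. -/
theorem inner_averageL (hκ : ReversibleKernel w κ) (f g : Lp ℝ 2 (weightMeasure w)) :
    inner ℝ (hκ.averageL 2 f) g = inner ℝ f (hκ.averageL 2 g) := by
  have hinner : ∀ f g : Lp ℝ 2 (weightMeasure w), HasSum (fun i => w i * (f i * g i)) (inner ℝ f g) := by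
    intro f g
    have := hasSum_integral_weightMeasure (fun j => (hκ.weight_pos j).le)
      (L2.integrable_inner (𝕜 := ℝ) f g)
    rw [L2.inner_def]
    simpa [mul_comm] using this
  set K : ℤ × ℤ → ℝ := fun x => w x.1 * (κ x.1 x.2 * f x.2 * g x.1) with hK
  have hsum : Summable K := by
    have h2 := (Equiv.prodComm ℤ ℤ).summable_iff.mpr (hκ.summable_weight_mul_sq f)
    refine Summable.of_norm_bounded (h2.add (hκ.summable_weight_mul_sq g)) fun x => ?_
    have hc : 0 ≤ w x.1 * κ x.1 x.2 := mul_nonneg (hκ.weight_pos _).le (hκ.nonneg _ _)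
    have e : w x.2 * κ x.2 x.1 = w x.1 * κ x.1 x.2 := hκ.reversible _ _
    simp only [Function.comp_apply, Equiv.prodComm_apply, Prod.fst_swap, Prod.snd_swap, e, hK]
    rw [show w x.1 * (κ x.1 x.2 * f x.2 * g x.1) = w x.1 * κ x.1 x.2 * (f x.2 * g x.1) by ring,
      norm_mul, Real.norm_of_nonneg hc, ← mul_add]
    refine mul_le_mul_of_nonneg_left ?_ hc
    rw [Real.norm_eq_abs, abs_le]
    constructor <;> nlinarith [sq_nonneg (f x.2 - g x.1), sq_nonneg (f x.2 + g x.1)]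
  have h1 := hsum.hasSum.prod_fiberwise fun i =>
    ((hκ.hasSum_average one_le_two (Lp.memLp f) i).mul_right (g i)).mul_left (w i)
  have h2 : HasSum (fun i => w i * (f i * average κ g i)) (∑' x, K x) :=
    ((Equiv.prodComm ℤ ℤ).hasSum_iff.mpr hsum.hasSum).prod_fiberwise fun i => by
      have := ((hκ.hasSum_average one_le_two (Lp.memLp g) i).mul_left (f i)).mul_left (w i)
      refine (congrArg (fun k => HasSum k _) (funext fun j => ?_)).mpr this
      simp only [hK, Function.comp_apply, Equiv.prodComm_apply, Prod.swap_prod_mk]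
      linear_combination f i * g j * hκ.reversible j i
  have e1 := hinner (hκ.averageL 2 f) g
  have e2 := hinner f (hκ.averageL 2 g)
  rw [hκ.coeFn_averageL] at e1 e2
  rw [e1.unique h1, e2.unique h2]

end ReversibleKernel

theorem IsTransitionFunction.reversibleKernel (hr : InwardRates α β) {p : ℝ≥0 → ℤ → ℤ → ℝ}
    (hp : IsTransitionFunction α β p) {w : ℤ → ℝ} (hw : IsStationaryDistribution α β w) (t : ℝ≥0) :
    ReversibleKernel w (p t) where
  weight_pos := hw.pos hr
  weight_sum := hw.hasSum_one
  nonneg := hp.nonneg t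
  hasSum_one := hp.hasSum_one t
  reversible := hp.reversible hr (hw.detailedBalance hr) (hw.pos hr) t

theorem IsTransitionFunction.isSemigroupOn_averageL (hr : InwardRates α β)
    {p : ℝ≥0 → ℤ → ℤ → ℝ} (hp : IsTransitionFunction α β p) {w : ℤ → ℝ}
    (hw : IsStationaryDistribution α β w) (q : ℝ≥0∞) [hq : Fact (1 ≤ q)] (t : ℝ≥0) :
    IsSemigroupOn α β w q t ((hp.reversibleKernel hr hw t).averageL q) := by
  intro u₀ u hb hu hu₀
  rw [ReversibleKernel.coeFn_averageL, eq_of_ae_eq_weightMeasure (hw.pos hr) hu₀.coeFn_toLp]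
  refine Eventually.of_forall fun i => ?_
  exact ((hp.reversibleKernel hr hw t).hasSum_average hq.out hu₀ i).unique
    (IsBackwardSolution.hasSum_kernel hr (hp.backward hr) hb hu t i)

/-- The defining condition fixes the operator on bounded sequences. These are everything for `q =
⊤`; otherwise they contain the simple functions, which are dense. -/
theorem IsSemigroupOn.unique (hr : InwardRates α β) {w : ℤ → ℝ}
    (hw : IsStationaryDistribution α β w) {q : ℝ≥0∞} [Fact (1 ≤ q)] {t : ℝ≥0}
    {T T' : Lp ℝ q (weightMeasure w) →L[ℝ] Lp ℝ q (weightMeasure w)}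
    (hT : IsSemigroupOn α β w q t T) (hT' : IsSemigroupOn α β w q t T') : T = T' := by
  have hbdd : ∀ f : Lp ℝ q (weightMeasure w), IsBounded f → T f = T' f := by
    intro f hf
    obtain ⟨u, hu, -⟩ := exists_backwardSolution hr hf
    have h1 := hT f u hf hu (Lp.memLp f)
    have h2 := hT' f u hf hu (Lp.memLp f)
    rw [Lp.toLp_coeFn] at h1 h2
    exact Lp.ext (h1.trans h2.symm)
  by_cases htop : q = ⊤
  · subst htop
    ext1 f
    refine hbdd f ⟨(eLpNormEssSup f (weightMeasure w)).toReal, fun j => ?_⟩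
    have hae := (ae_weightMeasure_iff (hw.pos hr)).mp
      (ae_le_eLpNormEssSup (f := f) (μ := weightMeasure w)) j
    have hfin : eLpNormEssSup f (weightMeasure w) ≠ ⊤ := by
      rw [← eLpNorm_exponent_top]
      exact Lp.eLpNorm_ne_top f
    have := ENNReal.toReal_mono hfin hae
    rwa [toReal_enorm] at this
  · refine DFunLike.coe_injective ((Lp.simpleFunc.denseRange htop).equalizer T.continuous
      T'.continuous (funext fun s => hbdd _ ?_))
    obtain ⟨C, hC⟩ := (Lp.simpleFunc.toSimpleFunc s).exists_forall_norm_le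
    refine ⟨C, fun j => ?_⟩
    rw [← eq_of_ae_eq_weightMeasure (hw.pos hr) (Lp.simpleFunc.toSimpleFunc_eq_toFun s)]
    exact hC j


/-! ### The upwind rates are inward -/

theorem Confining.tendsto_atTop {s : ℝ → ℝ} (hs : Confining s) : Tendsto s atTop atBot := by
  have h := hs.mono_left atTop_le_cocompact
  rw [← tendsto_neg_atTop_iff]
  refine h.congr' ?_
  filter_upwards [eventually_gt_atTop 0] with x hx
  rw [abs_of_pos hx, mul_div_cancel_right₀ _ hx.ne']

theorem Confining.tendsto_atBot {s : ℝ → ℝ} (hs : Confining s) : Tendsto s atBot atTop := by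
  have h := hs.mono_left atBot_le_cocompact
  refine h.congr' ?_
  filter_upwards [eventually_lt_atBot 0] with x hx
  rw [abs_of_neg hx, neg_mul, neg_div_neg_eq, mul_div_cancel_right₀ _ hx.ne]

theorem exists_bound_of_eventually_le {f : ℤ → ℝ} {A : ℝ} (h : ∀ᶠ j in atTop, f j ≤ A) (k : ℤ) :
    ∃ A', ∀ j, k ≤ j → f j ≤ A' := by
  obtain ⟨n, hn⟩ := eventually_atTop.mp h
  obtain ⟨M, hM⟩ := ((Set.finite_Icc k n).image f).bddAbove
  refine ⟨max A M, fun j hj => ?_⟩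
  rcases le_total n j with h | h
  · exact (hn j h).trans (le_max_left _ _)
  · exact (hM ⟨j, ⟨hj, h⟩, rfl⟩).trans (le_max_right _ _)

/-- Upwinding puts the drift into the rate that points along it. Far from the origin `s` points
inward, so outward rates are purely diffusive, at most `M ^ 2 / (2 * h ^ 2)`, while inward rates are
at least `|s| / h`. The finitely many remaining nodes only enlarge the bound. -/
theorem WeakConfinement.inwardRates {b σ : ℝ → ℝ} (hbσ : WeakConfinement b σ)
    (hs : Confining (speed b σ)) {h : ℝ} (hh : 0 < h) :
    InwardRates (upRate b σ h) (downRate b σ h) := by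
  obtain ⟨M, hM⟩ := hbσ.bounded
  obtain ⟨S, hS, hσ⟩ := hbσ.nondegenerate
  have hσM : ∀ x, σ x ^ 2 / (2 * h ^ 2) ≤ M ^ 2 / (2 * h ^ 2) := fun x =>
    div_le_div_of_nonneg_right (sq_le_sq' (abs_le.mp (hM x)).1 (abs_le.mp (hM x)).2) (by positivity)
  have hσ0 : ∀ x, 0 < σ x ^ 2 / (2 * h ^ 2) := fun x => by
    have := hS.trans_le (hσ x)
    positivity
  have hgrid : Tendsto (fun j : ℤ => (j : ℝ) * h) atTop atTop :=
    tendsto_intCast_atTop_atTop.atTop_mul_const hh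
  have hgrid' : Tendsto (fun j : ℤ => (j : ℝ) * h) atBot atBot :=
    (tendsto_intCast_atBot_iff.mpr tendsto_id).atBot_mul_const hh
  have hs1 := hs.tendsto_atTop.comp hgrid
  have hs2 := hs.tendsto_atBot.comp hgrid'
  refine ⟨fun j => ?_, fun j => ?_, ?_, ?_, ?_⟩
  · exact add_pos_of_nonneg_of_pos (div_nonneg (le_max_right _ _) hh.le) (hσ0 _)
  · exact add_pos_of_nonneg_of_pos (div_nonneg (le_max_right _ _) hh.le) (hσ0 _)
  · obtain ⟨A, hA⟩ := exists_bound_of_eventually_le (f := upRate b σ h) (A := M ^ 2 / (2 * h ^ 2))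
      (by
        filter_upwards [hs1.eventually_le_atBot 0] with j hj
        simp only [Function.comp_apply] at hj
        rw [upRate, max_eq_right hj, zero_div, zero_add]
        exact hσM _) 0
    obtain ⟨B, hB⟩ := exists_bound_of_eventually_le (f := fun j => downRate b σ h (-j))
      (A := M ^ 2 / (2 * h ^ 2))
      (by
        filter_upwards [(hs2.comp tendsto_neg_atTop_atBot).eventually_ge_atTop 0] with j hj
        simp only [Function.comp_apply] at hj
        rw [downRate, max_eq_right (neg_nonpos.mpr hj), zero_div, zero_add]
        exact hσM _) 0
    refine ⟨max A B, fun j hj => (hA j hj).trans (le_max_left _ _), fun j hj => ?_⟩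
    have := hB (-j) (by omega)
    rw [neg_neg] at this
    exact this.trans (le_max_right _ _)
  · refine tendsto_atTop_mono (fun j => ?_) ((tendsto_neg_atBot_atTop.comp hs1).atTop_div_const hh)
    simp only [Function.comp_apply]
    refine (div_le_div_of_nonneg_right (le_max_left _ 0) hh.le).trans ?_
    exact le_add_of_nonneg_right (hσ0 _).le
  · refine tendsto_atTop_mono (fun j => ?_) (hs2.atTop_div_const hh)
    simp only [Function.comp_apply]
    refine (div_le_div_of_nonneg_right (le_max_left _ 0) hh.le).trans ?_
    exact le_add_of_nonneg_right (hσ0 _).le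

end Upwind

theorem proposition4p1 (b σ : ℝ → ℝ) (hbσ : Upwind.WeakConfinement b σ)
    (hs : Upwind.Confining (Upwind.speed b σ)) (h : ℝ) (hh : 0 < h)
    (α β : ℤ → ℝ) (hα : α = Upwind.upRate b σ h) (hβ : β = Upwind.downRate b σ h) :
    -- the objects exist and are unique
    (∃! p, Upwind.IsTransitionFunction α β p) ∧
    (∃! w, Upwind.IsStationaryDistribution α β w) ∧
    (∀ u₀, Upwind.IsBounded u₀ → ∃! u, Upwind.IsBackwardSolution α β u₀ u) ∧
    -- (1) the semigroup acts by the transition function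
    (∀ p, Upwind.IsTransitionFunction α β p →
      ∀ u₀ u, Upwind.IsBounded u₀ → Upwind.IsBackwardSolution α β u₀ u →
        ∀ (t : ℝ≥0) (j : ℤ), HasSum (fun i => p t j i * u₀ i) (u t j)) ∧
    -- (2) the semigroup is TVD
    (∀ u₀ u, Summable (fun j => |u₀ j|) → Upwind.IsBackwardSolution α β u₀ u →
      (∀ t, Summable fun j : ℤ => |u t j - u t (j - 1)|) ∧
        Antitone fun t : ℝ≥0 => ∑' j : ℤ, |u t j - u t (j - 1)|) ∧
    ∀ w, Upwind.IsStationaryDistribution α β w →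
      -- the semigroup is a well-defined bounded operator on each weighted space
      (∀ (p : ℝ≥0∞) [Fact (1 ≤ p)] (t : ℝ≥0), ∃! T, Upwind.IsSemigroupOn α β w p t T) ∧
      -- (3) it is symmetric for `p = 2`
      (∀ (t : ℝ≥0) (T : Lp ℝ 2 (Upwind.weightMeasure w) →L[ℝ] Lp ℝ 2 (Upwind.weightMeasure w)),
        Upwind.IsSemigroupOn α β w 2 t T → ∀ f g, inner ℝ (T f) g = inner ℝ f (T g)) ∧
      -- (4) it is a contraction for all `p ∈ [1, ∞]`
      (∀ (p : ℝ≥0∞) [Fact (1 ≤ p)] (t : ℝ≥0)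
        (T : Lp ℝ p (Upwind.weightMeasure w) →L[ℝ] Lp ℝ p (Upwind.weightMeasure w)),
        Upwind.IsSemigroupOn α β w p t T → ‖T‖ ≤ 1) := by
  subst hα hβ
  have hr := hbσ.inwardRates hs hh
  obtain ⟨p₀, hp₀, -⟩ := Upwind.exists_transitionFunction hr
  refine ⟨Upwind.existsUnique_transitionFunction hr, Upwind.existsUnique_stationaryDistribution hr,
    fun u₀ hu₀ => Upwind.existsUnique_backwardSolution hr hu₀,
    fun p hp u₀ u hu₀ hu t j =>
      Upwind.IsBackwardSolution.hasSum_kernel hr (hp.backward hr) hu₀ hu t j,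
    fun u₀ u hu₀ hu => hu.totalVariation_diminishing hr hu₀, fun w hw => ?_⟩
  have hex := fun (p : ℝ≥0∞) [Fact (1 ≤ p)] (t : ℝ≥0) => hp₀.isSemigroupOn_averageL hr hw p t
  refine ⟨fun p _ t => ⟨_, hex p t, fun T hT => hT.unique hr hw (hex p t)⟩,
    fun t T hT f g => ?_, fun p _ t T hT => ?_⟩
  · rw [hT.unique hr hw (hex 2 t)]
    exact (hp₀.reversibleKernel hr hw t).inner_averageL f g
  · rw [hT.unique hr hw (hex p t)]
    exact (hp₀.reversibleKernel hr hw t).norm_averageL_le p
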